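/- Let $0<q<1$ and let $a,b,c,d\in\mathbb{C}$ satisfy $a\neq 0$ and $\max(|a|,|b|,|c|,|d|)<1$, with the non-real ones among $a,b,c,d$ occurring in complex conjugate pairs (i.e. the multiset $\{a,b,c,d\}$ is invariant under conjugation). Write $(\alpha;q)_n=\prod_{i=0}^{n-1}(1-\alpha q^i)$, $(\alpha;q)_\infty=\prod_{i\ge 0}(1-\alpha q^i)$, $(\alpha_1,\dots,\alpha_r;q)_n=\prod_j(\alpha_j;q)_n$ (also for $n=\infty$), and $h(x,\alpha)=\prod_{k\ge 0}(1-2\alpha xq^k+\alpha^2q^{2k})$. Let $P_n$ be the Askey–Wilson polynomials $$P_n(x)=\frac{(ab,ac,ad;q)_n}{(2a)^n(abcdq^{n-1};q)_n}\;{}_4\varphi_3\!\left(\begin{array}{c}q^{-n},\,abcdq^{n-1},\,az,\,az^{-1}\\ ab,\,ac,\,ad\end{array}\Big|\,q,q\right),\qquad x=\tfrac12(z+z^{-1}),$$ let $$\rho(x)=\frac{(q,ab,ac,ad,bc,bd,cd;q)_\infty\,h(x,1)h(x,-1)h(x,q^{1/2})h(x,-q^{1/2})}{2\pi\sqrt{1-x^2}\,(abcd;q)_\infty\,h(x,a)h(x,b)h(x,c)h(x,d)},\qquad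 -1<x<1,$$ and let $u$ be the Askey–Wilson functional $\langle u,p\rangle=\int_{-1}^1p(x)\rho(x)\,dx$ on complex polynomials $p$. Put $d_n^2=\langle u,P_n^2\rangle$ and $K_{n-1}(x,y)=\sum_{k=0}^{n-1}P_k(x)P_k(y)/d_k^2$ (so $K_{-1}=0$). Let $A,B>0$ and let $\tilde u=u+A\delta_{-1}+B\delta_1$, i.e. $\langle\tilde u,p\rangle=\langle u,p\rangle+A\,p(-1)+B\,p(1)$. Then the integral defining $\langle u,p\rangle$ converges absolutely for every polynomial $p$, every $d_n^2$ is real and positive, and for every $n\ge 0$ the number $$\kappa_{n-1}(-1,1)=\det\begin{pmatrix}1+AK_{n-1}(-1,-1)&BK_{n-1}(-1,1)\\ AK_{n-1}(1,-1)&1+BK_{n-1}(1,1)\end{pmatrix}$$ is real and positive. Moreover there is exactly one sequence $(\tilde P_n)_{n\ge 0}$ of monic polynomials with $\deg\tilde P_n=n$, $\langle\tilde u,\tilde P_n\tilde P_m\rangle=0$ for $n\ne m$ and $\langle\tilde u,\tilde P_n^2\rangle\neq 0$, and for every $n\ge 0$ it satisfies $$\tilde P_n(x)=P_n(x)-A\tilde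 P_n(-1)K_{n-1}(x,-1)-B\tilde P_n(1)K_{n-1}(x,1)\quad\text{for all }x,$$ $$\begin{pmatrix}\tilde P_n(-1)\\ \tilde P_n(1)\end{pmatrix}=\begin{pmatrix}1+AK_{n-1}(-1,-1)&BK_{n-1}(-1,1)\\ AK_{n-1}(1,-1)&1+BK_{n-1}(1,1)\end{pmatrix}^{-1}\begin{pmatrix}P_n(-1)\\ P_n(1)\end{pmatrix},$$ that is, $$\tilde P_n(-1)=\frac{(1+BK_{n-1}(1,1))P_n(-1)-BK_{n-1}(-1,1)P_n(1)}{\kappa_{n-1}(-1,1)},$$ $$\tilde P_n(1)=\frac{(1+AK_{n-1}(-1,-1))P_n(1)-AK_{n-1}(1,-1)P_n(-1)}{\kappa_{n-1}(-1,1)},$$ and its norm is $$\tilde d_n^2=\langle\tilde u,\tilde P_n^2\rangle=d_n^2+A\tilde P_n(-1)P_n(-1)+B\tilde P_n(1)P_n(1).$$ -/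

import Mathlib

open Polynomial
open scoped ComplexOrder

noncomputable section

/-- The finite shifted factorial `(a; q)_n = ∏_{i < n} (1 - a q^i)`. -/
def qPoch (a q : ℂ) (n : ℕ) : ℂ := ∏ i ∈ Finset.range n, (1 - a * q ^ i)

/-- The infinite shifted factorial `(a; q)_∞ = ∏_{i ≥ 0} (1 - a q^i)`. -/
def qPochInf (a q : ℂ) : ℂ := ∏' i : ℕ, (1 - a * q ^ i)

/-- The basic hypergeometric series
`₄φ₃(a₁, a₂, a₃, a₄; b₁, b₂, b₃ | q, z)
  = ∑_k (a₁, a₂, a₃, a₄; q)_k / (b₁, b₂, b₃, q; q)_k * z^k`. -/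
def basicPhi43 (a₁ a₂ a₃ a₄ b₁ b₂ b₃ q z : ℂ) : ℂ :=
  ∑' k : ℕ, qPoch a₁ q k * qPoch a₂ q k * qPoch a₃ q k * qPoch a₄ q k /
    (qPoch b₁ q k * qPoch b₂ q k * qPoch b₃ q k * qPoch q q k) * z ^ k

/-- The normalizing factor `(ab, ac, ad; q)_n / ((2a)^n (abcd q^{n-1}; q)_n)`. -/
def awPrefactor (q : ℝ) (a b c d : ℂ) (n : ℕ) : ℂ :=
  qPoch (a * b) q n * qPoch (a * c) q n * qPoch (a * d) q n /
    ((2 * a) ^ n * qPoch (a * b * c * d * (q : ℂ) ^ ((n : ℤ) - 1)) q n)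

/-- The Askey–Wilson polynomial `P_n(x; a, b, c, d | q)`, as a polynomial in `x`: the prefactor times
the terminating series `₄φ₃(q^{-n}, abcd q^{n-1}, a z, a / z; ab, ac, ad | q, q)`, in which
`(a z; q)_k (a / z; q)_k = ∏_{i < k} (1 - 2 a q^i x + a² q^{2 i})` for `x = (z + 1 / z) / 2`
(see `awPoly_eval`). -/
def awPoly (q : ℝ) (a b c d : ℂ) (n : ℕ) : ℂ[X] :=
  C (awPrefactor q a b c d n) *
    ∑ k ∈ Finset.range (n + 1),
      C (qPoch ((q : ℂ) ^ (-(n : ℤ))) q k * qPoch (a * b * c * d * (q : ℂ) ^ ((n : ℤ) - 1)) q k /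
          (qPoch (a * b) q k * qPoch (a * c) q k * qPoch (a * d) q k * qPoch q q k) * (q : ℂ) ^ k) *
        ∏ i ∈ Finset.range k,
          (1 - C (2 * a * (q : ℂ) ^ i) * X + C (a ^ 2 * (q : ℂ) ^ (2 * i)))

theorem qPoch_neg_pow_eq_zero (q : ℝ) (hq : 0 < q) (n k : ℕ) (h : n < k) :
    qPoch ((q : ℂ) ^ (-(n : ℤ))) q k = 0 := by
  have hq' : (q : ℂ) ≠ 0 := by exact_mod_cast hq.ne'
  refine Finset.prod_eq_zero (Finset.mem_range.2 h) ?_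
  rw [zpow_neg, zpow_natCast, inv_mul_cancel₀ (pow_ne_zero _ hq'), sub_self]

/-- `awPoly` is the polynomial given by the basic hypergeometric series on the lattice
`x = (z + 1 / z) / 2`. -/
theorem awPoly_eval (q : ℝ) (hq : 0 < q) (a b c d z : ℂ) (hz : z ≠ 0) (n : ℕ) :
    (awPoly q a b c d n).eval ((z + z⁻¹) / 2) =
      awPrefactor q a b c d n *
        basicPhi43 ((q : ℂ) ^ (-(n : ℤ))) (a * b * c * d * (q : ℂ) ^ ((n : ℤ) - 1)) (a * z) (a * z⁻¹)
          (a * b) (a * c) (a * d) q q := by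
  have key : ∀ k : ℕ, (∏ i ∈ Finset.range k,
      (1 - 2 * a * (q : ℂ) ^ i * ((z + z⁻¹) / 2) + a ^ 2 * (q : ℂ) ^ (2 * i))) =
      qPoch (a * z) q k * qPoch (a * z⁻¹) q k := by
    intro k
    rw [qPoch, qPoch, ← Finset.prod_mul_distrib]
    refine Finset.prod_congr rfl fun i _ => ?_
    have h1 : z * z⁻¹ = 1 := mul_inv_cancel₀ hz
    linear_combination (-(a ^ 2 * (q : ℂ) ^ (2 * i))) * h1
  rw [basicPhi43, tsum_eq_sum (s := Finset.range (n + 1))]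
  · simp only [awPoly, eval_mul, eval_C, eval_finsetSum, eval_prod, eval_add, eval_sub, eval_one,
      eval_X, key]
    congr 1
    refine Finset.sum_congr rfl fun k _ => ?_
    ring
  · intro k hk
    rw [qPoch_neg_pow_eq_zero q hq n k (by simpa using hk)]
    simp

/-- `h(x, α) = ∏_{k ≥ 0} (1 - 2 α x q^k + α² q^{2k})`. -/
def awH (q : ℝ) (x : ℝ) (α : ℂ) : ℂ :=
  ∏' k : ℕ, (1 - 2 * α * x * (q : ℂ) ^ k + α ^ 2 * (q : ℂ) ^ (2 * k))

/-- The Askey–Wilson weight function `ρ` on `(-1, 1)`. -/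
def awWeight (q : ℝ) (a b c d : ℂ) (x : ℝ) : ℂ :=
  (qPochInf q q * qPochInf (a * b) q * qPochInf (a * c) q * qPochInf (a * d) q *
      qPochInf (b * c) q * qPochInf (b * d) q * qPochInf (c * d) q *
      (awH q x 1 * awH q x (-1) * awH q x (Real.sqrt q) * awH q x (-Real.sqrt q))) /
    (2 * Real.pi * Real.sqrt (1 - x ^ 2) * qPochInf (a * b * c * d) q *
      (awH q x a * awH q x b * awH q x c * awH q x d))

/-- The Askey–Wilson functional `⟨u, p⟩ = ∫_{-1}^{1} p(x) ρ(x) dx`. -/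
def awFunctional (q : ℝ) (a b c d : ℂ) (p : ℂ[X]) : ℂ :=
  ∫ x in (-1 : ℝ)..1, p.eval (x : ℂ) * awWeight q a b c d x

/-- The modified functional `⟨u, p⟩ + A p(-1) + B p(1)`. -/
def krallFunctional (q : ℝ) (a b c d : ℂ) (A B : ℝ) (p : ℂ[X]) : ℂ :=
  awFunctional q a b c d p + A * p.eval (-1) + B * p.eval 1

/-- `P` is a sequence of monic orthogonal polynomials with respect to the functional `L`. -/
structure IsMonicOPS (L : ℂ[X] → ℂ) (P : ℕ → ℂ[X]) : Prop where
  monic : ∀ n, (P n).Monic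
  natDegree_eq : ∀ n, (P n).natDegree = n
  orthogonal : ∀ n m, n ≠ m → L (P n * P m) = 0
  norm_ne_zero : ∀ n, L (P n ^ 2) ≠ 0

/-- The squared norm `d_n² = ⟨u, P_n²⟩`. -/
def awNormSq (q : ℝ) (a b c d : ℂ) (n : ℕ) : ℂ :=
  awFunctional q a b c d (awPoly q a b c d n ^ 2)

/-- The kernel `K_{n-1}(x, y) = ∑_{k=0}^{n-1} P_k(x) P_k(y) / d_k²`, indexed by `n`
(so it is the empty sum for `n = 0`). -/
def awKernelPred (q : ℝ) (a b c d : ℂ) (n : ℕ) (x y : ℂ) : ℂ :=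
  ∑ k ∈ Finset.range n,
    (awPoly q a b c d k).eval x * (awPoly q a b c d k).eval y / awNormSq q a b c d k

/-- The matrix of the kernel system for the values at `-1` and `1`, with kernels `K_{n-1}`. -/
def kernelMatrix (q : ℝ) (a b c d : ℂ) (A B : ℝ) (n : ℕ) : Matrix (Fin 2) (Fin 2) ℂ :=
  !![1 + A * awKernelPred q a b c d n (-1) (-1), B * awKernelPred q a b c d n (-1) 1;
     A * awKernelPred q a b c d n 1 (-1), 1 + B * awKernelPred q a b c d n 1 1]

/-- The determinant `κ_{n-1}(-1, 1)`, indexed by `n`. -/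
def awKappaPred (q : ℝ) (a b c d : ℂ) (A B : ℝ) (n : ℕ) : ℂ :=
  (kernelMatrix q a b c d A B n).det

end

/-! The analytic core is the orthogonality of `awPoly` with respect to $u$; the masses at $\pm1$ are
then handled by linear algebra valid for any positive functional.

For orthogonality, put $x=\cos\theta$, $z=e^{i\theta}$. The weight becomes $\sin^2\theta$ times an
analytic function of $z$, and pairing with Chebyshev polynomials $U_{j-1}$ yields Laurent moments on
$|z|=1$. Moving the contour to $|z|=q$ crosses no pole, and the quasi-periodicity of the infinite
products turns this into a five-term recurrence for the moments (`circleMoment_recurrence`).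

Multiplication by $(az,a/z;q)_k$ replaces $a$ by $aq^k$ in the unnormalized functional
(`circleFunctional_mul_pow`). The recurrence gives the ratio of total masses under this shift
(`circleFunctional_one_mul_pow`). It also shows that, for $\deg p\le m$, the functional at $aq^k$
applied to $p$ is its total mass times a polynomial of degree at most $m$ in $q^k$, divided by
$(abcdq^k;q)_m$ (`isQRational_of_natDegree_le`). Inserting the ${}_4\varphi_3$ expansion of $P_n$
cancels all the shifted factorials but $(q^{-n};q)_k/(q;q)_k$, and the resulting sum vanishes by the
terminating $q$-binomial theorem. The Askey–Wilson integral itself is never evaluated.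

Conjugation invariance of $\{a,b,c,d\}$ makes the weight positive, so norms are positive and monic
orthogonal polynomials are unique. With the masses added, the reproducing kernel property verifies
the candidate whose values at $\pm1$ solve the $2\times2$ system (`isMonicOrth_addMasses`);
Cauchy–Schwarz keeps its determinant positive (`kernel_det_pos`). -/

noncomputable section

/-! ### Infinite $q$-shifted factorials: convergence, zeros, functional equations. -/

theorem summable_norm_mul_pow {q : ℝ} (hq0 : 0 < q) (hq1 : q < 1) (z : ℂ) :
    Summable fun n : ℕ => ‖-(z * (q : ℂ) ^ n)‖ := by
  simp only [norm_neg, norm_mul, norm_pow, Complex.norm_real, Real.norm_eq_abs, abs_of_pos hq0]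
  exact (summable_geometric_of_lt_one hq0.le hq1).mul_left _

theorem multipliable_one_sub_mul_pow {q : ℝ} (hq0 : 0 < q) (hq1 : q < 1) (z : ℂ) :
    Multipliable fun n : ℕ => 1 - z * (q : ℂ) ^ n := by
  simpa only [sub_eq_add_neg] using
    multipliable_one_add_of_summable (summable_norm_mul_pow hq0 hq1 z)

/-- `z ↦ (z; q)_∞` is entire. -/
theorem differentiable_qPochInf {q : ℝ} (hq0 : 0 < q) (hq1 : q < 1) :
    Differentiable ℂ fun z => qPochInf z q := by
  have key : HasProdLocallyUniformlyOn (fun (n : ℕ) (z : ℂ) => 1 + -(z * (q : ℂ) ^ n))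
      (fun z => ∏' n : ℕ, (1 + -(z * (q : ℂ) ^ n))) Set.univ := by
    apply hasProdLocallyUniformlyOn_of_forall_compact isOpen_univ
    intro K _ hcK
    obtain ⟨R, hR⟩ := hcK.isBounded.exists_norm_le
    refine ((summable_geometric_of_lt_one hq0.le hq1).mul_left R).hasProdUniformlyOn_nat_one_add
      hcK (.of_forall fun n x hx => ?_) (fun _ => by fun_prop)
    simp only [norm_neg, norm_mul, norm_pow, Complex.norm_real, Real.norm_eq_abs, abs_of_pos hq0]
    exact mul_le_mul_of_nonneg_right (hR x hx) (by positivity)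
  have h := key.differentiableOn
    (.of_forall fun _ => by simpa [Finset.prod_fn] using
      DifferentiableOn.finsetProd (fun _ _ => by fun_prop)) isOpen_univ
  rw [differentiableOn_univ] at h
  simpa only [qPochInf, sub_eq_add_neg] using h

theorem continuous_qPochInf {q : ℝ} (hq0 : 0 < q) (hq1 : q < 1) :
    Continuous fun z => qPochInf z q := (differentiable_qPochInf hq0 hq1).continuous

theorem norm_mul_ofReal_pow_le {q : ℝ} (hq0 : 0 < q) (hq1 : q < 1) (z : ℂ) (n : ℕ) :
    ‖z * (q : ℂ) ^ n‖ ≤ ‖z‖ := by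
  rw [norm_mul, norm_pow, Complex.norm_real, Real.norm_eq_abs, abs_of_pos hq0]
  exact mul_le_of_le_one_right (norm_nonneg _) (pow_le_one₀ hq0.le hq1.le)

theorem one_sub_ne_zero_of_norm_lt_one {z : ℂ} (hz : ‖z‖ < 1) : 1 - z ≠ 0 := by
  intro h
  rw [← sub_eq_zero.1 h] at hz
  simp at hz

theorem qPochInf_ne_zero {q : ℝ} (hq0 : 0 < q) (hq1 : q < 1) {z : ℂ} (hz : ‖z‖ < 1) :
    qPochInf z q ≠ 0 := by
  simp only [qPochInf, sub_eq_add_neg]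
  refine tprod_one_add_ne_zero_of_summable (fun i => ?_) (summable_norm_mul_pow hq0 hq1 z)
  rw [← sub_eq_add_neg]
  exact one_sub_ne_zero_of_norm_lt_one ((norm_mul_ofReal_pow_le hq0 hq1 z i).trans_lt hz)

theorem qPoch_ne_zero {q : ℝ} (hq0 : 0 < q) (hq1 : q < 1) {z : ℂ} (hz : ‖z‖ < 1) (n : ℕ) :
    qPoch z q n ≠ 0 :=
  Finset.prod_ne_zero_iff.2 fun i _ =>
    one_sub_ne_zero_of_norm_lt_one ((norm_mul_ofReal_pow_le hq0 hq1 z i).trans_lt hz)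

theorem qPoch_add (z q : ℂ) (m n : ℕ) :
    qPoch z q (m + n) = qPoch z q m * qPoch (z * q ^ m) q n := by
  simp only [qPoch, Finset.prod_range_add, pow_add, mul_assoc]

theorem qPoch_succ (z q : ℂ) (n : ℕ) : qPoch z q (n + 1) = qPoch z q n * (1 - z * q ^ n) :=
  Finset.prod_range_succ _ _

theorem qPochInf_eq_mul {q : ℝ} (hq0 : 0 < q) (hq1 : q < 1) (z : ℂ) :
    qPochInf z q = (1 - z) * qPochInf (z * q) q := by
  rw [qPochInf, qPochInf, tprod_eq_zero_mul']
  · simp [pow_succ', mul_assoc]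
  · simpa [pow_succ', mul_assoc] using multipliable_one_sub_mul_pow hq0 hq1 (z * q)

theorem qPochInf_conj (q : ℝ) (z : ℂ) :
    qPochInf (starRingEnd ℂ z) q = starRingEnd ℂ (qPochInf z q) := by
  have : Function.LeftInverse (starRingEnd ℂ) (starRingEnd ℂ) := Complex.conj_conj
  rw [qPochInf, qPochInf, Function.LeftInverse.map_tprod _ (g := starRingEnd ℂ)
    Complex.continuous_conj Complex.continuous_conj this]
  simp

/-- `(y, -y, q^{1/2} y, -q^{1/2} y; q)_∞ = (y²; q)_∞`. -/
theorem qPochInf_sq {q : ℝ} (hq0 : 0 < q) (hq1 : q < 1) (y : ℂ) :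
    qPochInf y q * qPochInf (-y) q * (qPochInf (Real.sqrt q * y) q * qPochInf (-Real.sqrt q * y) q)
      = qPochInf (y ^ 2) q := by
  have hs : (Real.sqrt q : ℂ) ^ 2 = q := by exact_mod_cast Real.sq_sqrt hq0.le
  have m := fun z => multipliable_one_sub_mul_pow hq0 hq1 z
  -- The pair $\pm y$ supplies the even powers of $q$ in $(y^2;q)_\infty$, the pair $\pm q^{1/2}y$
  -- the odd ones.
  have e1 : ∀ k : ℕ, (1 - y * (q : ℂ) ^ k) * (1 - -y * (q : ℂ) ^ k) =
      1 - y ^ 2 * (q : ℂ) ^ (2 * k) := fun k => by ring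
  have e2 : ∀ k : ℕ, (1 - Real.sqrt q * y * (q : ℂ) ^ k) * (1 - -Real.sqrt q * y * (q : ℂ) ^ k) =
      1 - y ^ 2 * (q : ℂ) ^ (2 * k + 1) := fun k => by
    rw [pow_succ _ (2 * k)]
    linear_combination (-(y ^ 2) * (q : ℂ) ^ (2 * k)) * hs
  have m1 := (m y).mul (m (-y))
  have m2 := (m (Real.sqrt q * y)).mul (m (-Real.sqrt q * y))
  simp only [e1] at m1
  simp only [e2] at m2
  simp only [qPochInf]
  rw [← (m y).tprod_mul (m (-y)), ← (m (Real.sqrt q * y)).tprod_mul (m (-Real.sqrt q * y))]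
  simp only [e1, e2]
  exact tprod_even_mul_odd (f := fun k => 1 - y ^ 2 * (q : ℂ) ^ k) m1 m2

/-! ### The weight and the functional on the unit circle. -/

theorem awH_eq {q : ℝ} (hq0 : 0 < q) (hq1 : q < 1) {x : ℝ} {z : ℂ} (hz : z ≠ 0)
    (hx : (x : ℂ) = (z + z⁻¹) / 2) (α : ℂ) :
    awH q x α = qPochInf (α * z) q * qPochInf (α * z⁻¹) q := by
  rw [qPochInf, qPochInf, ← (multipliable_one_sub_mul_pow hq0 hq1 _).tprod_mul
    (multipliable_one_sub_mul_pow hq0 hq1 _), awH]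
  refine tprod_congr fun k => ?_
  rw [hx]
  have h1 : z * z⁻¹ = 1 := mul_inv_cancel₀ hz
  linear_combination (-(α ^ 2 * (q : ℂ) ^ (2 * k))) * h1

/-- The numerator of the Askey–Wilson weight on the unit circle. -/
theorem awH_numerator {q : ℝ} (hq0 : 0 < q) (hq1 : q < 1) {x : ℝ} {z : ℂ} (hz : z ≠ 0)
    (hx : (x : ℂ) = (z + z⁻¹) / 2) :
    awH q x 1 * awH q x (-1) * awH q x (Real.sqrt q) * awH q x (-Real.sqrt q) =
      4 * (1 - x ^ 2) * (qPochInf (q * z ^ 2) q * qPochInf (q * (z⁻¹) ^ 2) q) := by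
  have h1 := qPochInf_sq hq0 hq1 z
  have h2 := qPochInf_sq hq0 hq1 z⁻¹
  rw [qPochInf_eq_mul hq0 hq1 (_ ^ 2)] at h1 h2
  have h3 : 4 * (1 - (x : ℂ) ^ 2) = (1 - z ^ 2) * (1 - z⁻¹ ^ 2) := by
    rw [hx]; field_simp; ring
  have h4 := congrArg₂ (· * ·) h1 h2
  rw [h3, awH_eq hq0 hq1 hz hx, awH_eq hq0 hq1 hz hx, awH_eq hq0 hq1 hz hx, awH_eq hq0 hq1 hz hx,
    mul_comm (q : ℂ), mul_comm (q : ℂ)]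
  simp only [one_mul, neg_one_mul]
  linear_combination h4

/-- The analytic part of the Askey–Wilson weight in the variable `z`, `x = (z + 1 / z) / 2`. -/
def circleG (q : ℝ) (a b c d z : ℂ) : ℂ :=
  qPochInf (q * z ^ 2) q * qPochInf (q * z⁻¹ ^ 2) q /
    (qPochInf (a * z) q * qPochInf (a * z⁻¹) q * (qPochInf (b * z) q * qPochInf (b * z⁻¹) q) *
      (qPochInf (c * z) q * qPochInf (c * z⁻¹) q) * (qPochInf (d * z) q * qPochInf (d * z⁻¹) q))

/-- The point `e^{iθ}` of the unit circle. -/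
def unitPt (θ : ℝ) : ℂ := Complex.exp (θ * Complex.I)

theorem norm_unitPt (θ : ℝ) : ‖unitPt θ‖ = 1 := Complex.norm_exp_ofReal_mul_I θ

theorem unitPt_ne_zero (θ : ℝ) : unitPt θ ≠ 0 := Complex.exp_ne_zero _

theorem continuous_unitPt : Continuous unitPt := by unfold unitPt; fun_prop

theorem unitPt_inv (θ : ℝ) : (unitPt θ)⁻¹ = Complex.exp (-(θ * Complex.I)) :=
  (Complex.exp_neg _).symm

theorem continuous_unitPt_inv : Continuous fun θ => (unitPt θ)⁻¹ :=
  continuous_unitPt.inv₀ unitPt_ne_zero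

theorem unitPt_two_pi_sub (θ : ℝ) : unitPt (2 * Real.pi - θ) = (unitPt θ)⁻¹ := by
  rw [unitPt_inv, unitPt]
  push_cast
  rw [sub_mul, Complex.exp_sub, Complex.exp_two_pi_mul_I, Complex.exp_neg, one_div]

theorem cos_eq_unitPt (θ : ℝ) : (Real.cos θ : ℂ) = (unitPt θ + (unitPt θ)⁻¹) / 2 := by
  rw [unitPt_inv, Complex.ofReal_cos, Complex.cos, unitPt, neg_mul]

theorem sin_eq_unitPt (θ : ℝ) :
    (Real.sin θ : ℂ) = ((unitPt θ)⁻¹ - unitPt θ) * Complex.I / 2 := by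
  rw [unitPt_inv, Complex.ofReal_sin, Complex.sin, unitPt, neg_mul]

theorem circleG_inv (q : ℝ) (a b c d z : ℂ) : circleG q a b c d z⁻¹ = circleG q a b c d z := by
  simp only [circleG, inv_inv]
  congr 1
  · ring
  · ring

theorem qPochInf_mul_unitPt_ne_zero {q : ℝ} (hq0 : 0 < q) (hq1 : q < 1) {α : ℂ} (hα : ‖α‖ < 1)
    (θ : ℝ) : qPochInf (α * unitPt θ) q * qPochInf (α * (unitPt θ)⁻¹) q ≠ 0 :=
  mul_ne_zero (qPochInf_ne_zero hq0 hq1 (by simpa [norm_unitPt] using hα))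
    (qPochInf_ne_zero hq0 hq1 (by simpa [norm_unitPt] using hα))

theorem continuous_circleG {q : ℝ} (hq0 : 0 < q) (hq1 : q < 1) {a b c d : ℂ}
    (ha : ‖a‖ < 1) (hb : ‖b‖ < 1) (hc : ‖c‖ < 1) (hd : ‖d‖ < 1) :
    Continuous fun θ => circleG q a b c d (unitPt θ) := by
  have h := continuous_qPochInf hq0 hq1
  have h1 := continuous_unitPt
  have h2 := continuous_unitPt_inv
  have h3 : ∀ α : ℂ, Continuous fun θ =>
      qPochInf (α * unitPt θ) q * qPochInf (α * (unitPt θ)⁻¹) q := fun α =>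
    (h.comp (continuous_const.mul h1)).mul (h.comp (continuous_const.mul h2))
  refine Continuous.div ((h.comp (continuous_const.mul (h1.pow 2))).mul
    (h.comp (continuous_const.mul (h2.pow 2)))) ((((h3 a).mul (h3 b)).mul (h3 c)).mul (h3 d)) ?_
  intro θ
  have h4 := fun {α : ℂ} (hα : ‖α‖ < 1) => qPochInf_mul_unitPt_ne_zero hq0 hq1 hα θ
  exact mul_ne_zero (mul_ne_zero (mul_ne_zero (h4 ha) (h4 hb)) (h4 hc)) (h4 hd)

/-- The constant factor of the Askey–Wilson weight. -/
def awConst (q : ℝ) (a b c d : ℂ) : ℂ :=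
  (qPochInf q q * qPochInf (a * b) q * qPochInf (a * c) q * qPochInf (a * d) q *
      qPochInf (b * c) q * qPochInf (b * d) q * qPochInf (c * d) q) /
    (2 * Real.pi * qPochInf (a * b * c * d) q)

/-- The numerator of the weight contains $4(1-x^2)$, which turns the singular factor
$1/\sqrt{1-x^2}$ into $\sqrt{1-x^2}$. In this form continuity and positivity are visible. -/
theorem awWeight_eq {q : ℝ} (hq0 : 0 < q) (hq1 : q < 1) (a b c d : ℂ) (x : ℝ) :
    awWeight q a b c d x = 4 * awConst q a b c d *
      (Real.sqrt (1 - x ^ 2) * circleG q a b c d (unitPt (Real.arccos x))) := by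
  by_cases hx : x ^ 2 ≤ 1
  · have hx' : (x : ℂ) = (unitPt (Real.arccos x) + (unitPt (Real.arccos x))⁻¹) / 2 := by
      rw [← cos_eq_unitPt, Real.cos_arccos] <;> nlinarith
    have hz := unitPt_ne_zero (Real.arccos x)
    have hs : (1 - (x : ℂ) ^ 2) / (Real.sqrt (1 - x ^ 2) : ℂ) = Real.sqrt (1 - x ^ 2) := by
      have := Real.div_sqrt (x := 1 - x ^ 2)
      exact_mod_cast this
    rw [awWeight, awH_numerator hq0 hq1 hz hx', awH_eq hq0 hq1 hz hx', awH_eq hq0 hq1 hz hx',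
      awH_eq hq0 hq1 hz hx', awH_eq hq0 hq1 hz hx', awConst, circleG]
    conv_rhs => rw [← hs]
    simp only [div_eq_mul_inv, mul_inv]
    ring
  -- For $|x|>1$ both sides are $0$, the left one through division by zero. The formula is thus
  -- global and gives continuity of the weight on all of ℝ.
  · have hs : Real.sqrt (1 - x ^ 2) = 0 := Real.sqrt_eq_zero_of_nonpos (by linarith)
    simp [awWeight, hs]

theorem continuous_awWeight {q : ℝ} (hq0 : 0 < q) (hq1 : q < 1) {a b c d : ℂ}
    (ha : ‖a‖ < 1) (hb : ‖b‖ < 1) (hc : ‖c‖ < 1) (hd : ‖d‖ < 1) :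
    Continuous (awWeight q a b c d) := by
  simp only [funext (awWeight_eq hq0 hq1 a b c d)]
  have h1 := (continuous_circleG hq0 hq1 ha hb hc hd).comp Real.continuous_arccos
  have h2 : Continuous fun x : ℝ => (Real.sqrt (1 - x ^ 2) : ℂ) := by fun_prop
  exact continuous_const.mul (h2.mul h1)

theorem continuous_eval_ofReal (p : ℂ[X]) : Continuous fun x : ℝ => p.eval (x : ℂ) :=
  p.continuous.comp Complex.continuous_ofReal

/-- The integrand of the Askey–Wilson functional on the circle. -/
def circleIntegrand (q : ℝ) (a b c d : ℂ) (p : ℂ[X]) (θ : ℝ) : ℂ :=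
  p.eval (Real.cos θ : ℂ) * ((Real.sin θ : ℂ) ^ 2 * circleG q a b c d (unitPt θ))

theorem continuous_circleIntegrand {q : ℝ} (hq0 : 0 < q) (hq1 : q < 1) {a b c d : ℂ}
    (ha : ‖a‖ < 1) (hb : ‖b‖ < 1) (hc : ‖c‖ < 1) (hd : ‖d‖ < 1) (p : ℂ[X]) :
    Continuous (circleIntegrand q a b c d p) := by
  have h1 := continuous_circleG hq0 hq1 ha hb hc hd
  have h2 : Continuous fun θ : ℝ => (Real.sin θ : ℂ) ^ 2 := by fun_prop
  exact ((continuous_eval_ofReal p).comp Real.continuous_cos).mul (h2.mul h1)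

/-- The unnormalized Askey–Wilson functional as an integral over the circle. -/
def circleFunctional (q : ℝ) (a b c d : ℂ) (p : ℂ[X]) : ℂ :=
  ∫ θ in (0 : ℝ)..2 * Real.pi, circleIntegrand q a b c d p θ

theorem circleIntegrand_two_pi_sub (q : ℝ) (a b c d : ℂ) (p : ℂ[X]) (θ : ℝ) :
    circleIntegrand q a b c d p (2 * Real.pi - θ) = circleIntegrand q a b c d p θ := by
  simp only [circleIntegrand, unitPt_two_pi_sub, circleG_inv, Real.cos_two_pi_sub,
    Real.sin_two_pi_sub]
  push_cast
  ring

theorem circleFunctional_eq_two_mul {q : ℝ} (hq0 : 0 < q) (hq1 : q < 1) {a b c d : ℂ}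
    (ha : ‖a‖ < 1) (hb : ‖b‖ < 1) (hc : ‖c‖ < 1) (hd : ‖d‖ < 1) (p : ℂ[X]) :
    circleFunctional q a b c d p =
      2 * ∫ θ in (0 : ℝ)..Real.pi, circleIntegrand q a b c d p θ := by
  have hcont := continuous_circleIntegrand hq0 hq1 ha hb hc hd p
  have h := intervalIntegral.integral_comp_sub_left (a := 0) (b := Real.pi)
    (circleIntegrand q a b c d p) (2 * Real.pi)
  simp only [circleIntegrand_two_pi_sub, sub_zero] at h
  rw [show 2 * Real.pi - Real.pi = Real.pi by ring] at h
  rw [circleFunctional, ← intervalIntegral.integral_add_adjacent_intervals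
    (hcont.intervalIntegrable 0 Real.pi) (hcont.intervalIntegrable _ _), ← h]
  ring

/-- Substitute $x=\cos\theta$: the Jacobian supplies the second factor $\sin\theta$, and symmetry
under $\theta\mapsto2\pi-\theta$ extends the half circle to the full one. -/
theorem awFunctional_eq {q : ℝ} (hq0 : 0 < q) (hq1 : q < 1) {a b c d : ℂ}
    (ha : ‖a‖ < 1) (hb : ‖b‖ < 1) (hc : ‖c‖ < 1) (hd : ‖d‖ < 1) (p : ℂ[X]) :
    awFunctional q a b c d p = 2 * awConst q a b c d * circleFunctional q a b c d p := by
  have hcont : Continuous fun x : ℝ => p.eval (x : ℂ) * awWeight q a b c d x :=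
    (continuous_eval_ofReal p).mul (continuous_awWeight hq0 hq1 ha hb hc hd)
  have h := intervalIntegral.integral_deriv_smul_comp (a := 0) (b := Real.pi)
    (f := Real.cos) (f' := fun θ => -Real.sin θ) (fun θ _ => Real.hasDerivAt_cos θ)
    (by fun_prop) hcont
  rw [Real.cos_zero, Real.cos_pi, intervalIntegral.integral_symm (-1 : ℝ) 1] at h
  have h2 : ∀ θ ∈ Set.uIcc 0 Real.pi,
      -Real.sin θ • ((fun x : ℝ => p.eval (x : ℂ) * awWeight q a b c d x) ∘ Real.cos) θ =
        -(4 * awConst q a b c d) * circleIntegrand q a b c d p θ := by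
    intro θ hθ
    rw [Set.uIcc_of_le Real.pi_pos.le] at hθ
    have hsin := Real.sin_nonneg_of_mem_Icc hθ
    rw [Function.comp_apply, awWeight_eq hq0 hq1, Real.arccos_cos hθ.1 hθ.2,
      ← Real.abs_sin_eq_sqrt_one_sub_cos_sq, abs_of_nonneg hsin, circleIntegrand,
      Complex.real_smul]
    push_cast
    ring
  rw [intervalIntegral.integral_congr h2, intervalIntegral.integral_const_mul] at h
  rw [circleFunctional_eq_two_mul hq0 hq1 ha hb hc hd, awFunctional]
  linear_combination h

/-! ### Contour shift and the five-term recurrence for the moments. -/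

/-- The function whose contour is shifted from `|z| = 1` to `|z| = q`. -/
def shiftPhi (q : ℝ) (a b c d : ℂ) (j : ℤ) (z : ℂ) : ℂ :=
  z ^ (j + 2) * (z - z⁻¹) * (qPochInf (q * z ^ 2) q * qPochInf (q * z⁻¹ ^ 2) q) /
    (qPochInf (a * z) q * qPochInf (a * q * z⁻¹) q *
      (qPochInf (b * z) q * qPochInf (b * q * z⁻¹) q) *
      (qPochInf (c * z) q * qPochInf (c * q * z⁻¹) q) *
      (qPochInf (d * z) q * qPochInf (d * q * z⁻¹) q))

/-- With $\alpha q/z$ in place of $\alpha/z$, both arguments $\alpha z$ and $\alpha q/z$ have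
modulus at most $|\alpha|<1$ on the closed annulus, so no denominator vanishes there. -/
theorem differentiableAt_shiftPhi {q : ℝ} (hq0 : 0 < q) (hq1 : q < 1) {a b c d : ℂ}
    (ha : ‖a‖ < 1) (hb : ‖b‖ < 1) (hc : ‖c‖ < 1) (hd : ‖d‖ < 1) (j : ℤ) {z : ℂ}
    (hz0 : q ≤ ‖z‖) (hz1 : ‖z‖ ≤ 1) : DifferentiableAt ℂ (shiftPhi q a b c d j) z := by
  have hz : z ≠ 0 := norm_pos_iff.1 (hq0.trans_le hz0)
  have h := differentiable_qPochInf hq0 hq1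
  have hinv : DifferentiableAt ℂ (fun z : ℂ => z⁻¹) z := differentiableAt_inv hz
  have hcomp : ∀ {f : ℂ → ℂ}, DifferentiableAt ℂ f z →
      DifferentiableAt ℂ (fun z => qPochInf (f z) q) z := fun {f} hf =>
    (h (f z)).comp z hf
  have hne : ∀ {α : ℂ}, ‖α‖ < 1 →
      qPochInf (α * z) q * qPochInf (α * q * z⁻¹) q ≠ 0 := by
    intro α hα
    refine mul_ne_zero (qPochInf_ne_zero hq0 hq1 ?_) (qPochInf_ne_zero hq0 hq1 ?_)
    · rw [norm_mul]
      exact (mul_le_of_le_one_right (norm_nonneg _) hz1).trans_lt hα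
    · rw [mul_assoc, norm_mul]
      refine (mul_le_of_le_one_right (norm_nonneg _) ?_).trans_lt hα
      rw [norm_mul, norm_inv, Complex.norm_real, Real.norm_eq_abs, abs_of_pos hq0,
        ← div_eq_mul_inv]
      exact div_le_one_of_le₀ hz0 (norm_nonneg _)
  have hd1 : ∀ α : ℂ, DifferentiableAt ℂ
      (fun z => qPochInf (α * z) q * qPochInf (α * q * z⁻¹) q) z := fun α =>
    (hcomp (by fun_prop)).mul (hcomp (hinv.const_mul _))
  refine DifferentiableAt.div ?_ ((((hd1 a).mul (hd1 b)).mul (hd1 c)).mul (hd1 d))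
    (mul_ne_zero (mul_ne_zero (mul_ne_zero (hne ha) (hne hb)) (hne hc)) (hne hd))
  exact ((differentiableAt_zpow.2 (Or.inl hz)).mul (differentiableAt_id.sub hinv)).mul
    ((hcomp (by fun_prop)).mul (hcomp ((hinv.pow 2).const_mul _)))

theorem integral_shiftPhi {q : ℝ} (hq0 : 0 < q) (hq1 : q < 1) {a b c d : ℂ}
    (ha : ‖a‖ < 1) (hb : ‖b‖ < 1) (hc : ‖c‖ < 1) (hd : ‖d‖ < 1) (j : ℤ) :
    ∫ θ in (0 : ℝ)..2 * Real.pi, shiftPhi q a b c d j (unitPt θ) =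
      ∫ θ in (0 : ℝ)..2 * Real.pi, shiftPhi q a b c d j (q * unitPt θ) := by
  have hdiff := fun {z : ℂ} (h0 : q ≤ ‖z‖) (h1 : ‖z‖ ≤ 1) =>
    differentiableAt_shiftPhi hq0 hq1 ha hb hc hd j h0 h1
  have key := Complex.circleIntegral_sub_center_inv_smul_eq_of_differentiable_on_annulus_off_countable
    (c := 0) (f := shiftPhi q a b c d j) hq0 hq1.le Set.countable_empty
    (fun z hz => (hdiff (by simpa using hz.2) (by simpa using hz.1)).continuousAt.continuousWithinAt)
    (fun z hz => hdiff (le_of_lt (by simpa using hz.1.2)) (le_of_lt (by simpa using hz.1.1)))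
  have hcirc : ∀ R : ℝ, 0 < R → (∮ z in C(0, R), (z - 0)⁻¹ • shiftPhi q a b c d j z) =
      Complex.I * ∫ θ in (0 : ℝ)..2 * Real.pi, shiftPhi q a b c d j (R * unitPt θ) := by
    intro R hR
    rw [circleIntegral, ← intervalIntegral.integral_const_mul]
    refine intervalIntegral.integral_congr fun θ _ => ?_
    have hne : circleMap 0 R θ ≠ 0 := circleMap_ne_center hR.ne'
    have : circleMap 0 R θ = R * unitPt θ := circleMap_zero _ _
    simp only [deriv_circleMap, sub_zero, smul_eq_mul]
    rw [← this]
    field_simp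
  rw [hcirc 1 one_pos, hcirc q hq0] at key
  simpa using mul_left_cancel₀ Complex.I_ne_zero key

/-- On the outer circle the missing factors $1-\alpha/z$ reappear in the numerator. On the inner
circle (`shiftPhi_mul_unitPt`) it is $1-\alpha z$ instead, and the comparison of the two yields the
recurrence. -/
theorem shiftPhi_unitPt {q : ℝ} (hq0 : 0 < q) (hq1 : q < 1) {a b c d : ℂ}
    (ha : ‖a‖ < 1) (hb : ‖b‖ < 1) (hc : ‖c‖ < 1) (hd : ‖d‖ < 1) (j : ℤ) (θ : ℝ) :
    shiftPhi q a b c d j (unitPt θ) =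
      unitPt θ ^ (j + 2) * ((1 - a * (unitPt θ)⁻¹) * (1 - b * (unitPt θ)⁻¹) *
        (1 - c * (unitPt θ)⁻¹) * (1 - d * (unitPt θ)⁻¹)) *
        ((unitPt θ - (unitPt θ)⁻¹) * circleG q a b c d (unitPt θ)) := by
  have hne : ∀ {α : ℂ}, ‖α‖ < 1 → 1 - α * (unitPt θ)⁻¹ ≠ 0 := fun hα =>
    one_sub_ne_zero_of_norm_lt_one (by simpa [norm_unitPt] using hα)
  have hrec : ∀ α : ℂ, qPochInf (α * (unitPt θ)⁻¹) q =
      (1 - α * (unitPt θ)⁻¹) * qPochInf (α * q * (unitPt θ)⁻¹) q := fun α => by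
    rw [qPochInf_eq_mul hq0 hq1, mul_right_comm α]
  have h1 := hne ha
  have h2 := hne hb
  have h3 := hne hc
  have h4 := hne hd
  rw [shiftPhi, circleG, hrec a, hrec b, hrec c, hrec d]
  generalize (1 - a * (unitPt θ)⁻¹) = x1 at *
  generalize (1 - b * (unitPt θ)⁻¹) = x2 at *
  generalize (1 - c * (unitPt θ)⁻¹) = x3 at *
  generalize (1 - d * (unitPt θ)⁻¹) = x4 at *
  have : x1 * x2 * x3 * x4 * (x1 * x2 * x3 * x4)⁻¹ = 1 :=
    mul_inv_cancel₀ (by simp [h1, h2, h3, h4])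
  simp only [div_eq_mul_inv, mul_inv] at this ⊢
  generalize unitPt θ ^ (j + 2) = y
  generalize (unitPt θ - (unitPt θ)⁻¹) = w
  generalize qPochInf (↑q * unitPt θ ^ 2) ↑q * qPochInf (↑q * (unitPt θ)⁻¹ ^ 2) ↑q = v
  generalize (qPochInf (_ * (unitPt θ)) ↑q)⁻¹ = u1
  generalize (qPochInf (_ * (unitPt θ)) ↑q)⁻¹ = u2
  generalize (qPochInf (_ * (unitPt θ)) ↑q)⁻¹ = u3
  generalize (qPochInf (_ * (unitPt θ)) ↑q)⁻¹ = u4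
  generalize (qPochInf (_ * (unitPt θ)⁻¹) ↑q)⁻¹ = t1
  generalize (qPochInf (_ * (unitPt θ)⁻¹) ↑q)⁻¹ = t2
  generalize (qPochInf (_ * (unitPt θ)⁻¹) ↑q)⁻¹ = t3
  generalize (qPochInf (_ * (unitPt θ)⁻¹) ↑q)⁻¹ = t4
  linear_combination (-(y * w * v * (u1 * t1) * (u2 * t2) * (u3 * t3) * (u4 * t4))) * this

theorem shiftPhi_mul_unitPt {q : ℝ} (hq0 : 0 < q) (hq1 : q < 1) {a b c d : ℂ}
    (ha : ‖a‖ < 1) (hb : ‖b‖ < 1) (hc : ‖c‖ < 1) (hd : ‖d‖ < 1) (j : ℤ) (θ : ℝ) :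
    shiftPhi q a b c d j (q * unitPt θ) =
      (q : ℂ) ^ j * (unitPt θ ^ (j - 2) * ((1 - a * unitPt θ) * (1 - b * unitPt θ) *
        (1 - c * unitPt θ) * (1 - d * unitPt θ)) *
        ((unitPt θ - (unitPt θ)⁻¹) * circleG q a b c d (unitPt θ))) := by
  have hq : (q : ℂ) ≠ 0 := by exact_mod_cast hq0.ne'
  have hz := unitPt_ne_zero θ
  have hne : ∀ {α : ℂ}, ‖α‖ < 1 → 1 - α * unitPt θ ≠ 0 := fun hα =>
    one_sub_ne_zero_of_norm_lt_one (by simpa [norm_unitPt] using hα)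
  have hrec : ∀ α : ℂ, qPochInf (α * unitPt θ) q =
      (1 - α * unitPt θ) * qPochInf (α * (q * unitPt θ)) q := fun α => by
    rw [qPochInf_eq_mul hq0 hq1, mul_assoc, mul_comm (unitPt θ)]
  have hinv : ∀ α : ℂ, α * q * (q * unitPt θ)⁻¹ = α * (unitPt θ)⁻¹ := fun α => by
    field_simp
  have h5 : qPochInf (q * unitPt θ ^ 2) q = (1 - q * unitPt θ ^ 2) * ((1 - (q * unitPt θ) ^ 2) *
      qPochInf (q * (q * unitPt θ) ^ 2) q) := by
    rw [qPochInf_eq_mul hq0 hq1, qPochInf_eq_mul hq0 hq1 (_ * (q : ℂ))]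
    ring_nf
  have h6 : qPochInf (q * (q * unitPt θ)⁻¹ ^ 2) q = (1 - (q * unitPt θ ^ 2)⁻¹) *
      ((1 - (unitPt θ)⁻¹ ^ 2) * qPochInf (q * (unitPt θ)⁻¹ ^ 2) q) := by
    have e1 : q * (q * unitPt θ)⁻¹ ^ 2 = (q * unitPt θ ^ 2)⁻¹ := by field_simp
    have e2 : (q * unitPt θ ^ 2)⁻¹ * q = (unitPt θ)⁻¹ ^ 2 := by field_simp
    rw [e1, qPochInf_eq_mul hq0 hq1, e2, qPochInf_eq_mul hq0 hq1 (_ ^ 2), mul_comm _ (q : ℂ)]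
  -- Under $z\mapsto qz$ the product $(qz^2;q)_\infty$ loses two factors and $(qz^{-2};q)_\infty$
  -- gains two. Their quotient is a monomial up to the change in $z-z^{-1}$. The exponent $j+2$
  -- makes both circles produce the powers $z^{j-2},\dots,z^{j+2}$.
  have h7 : (q * unitPt θ) ^ (j + 2) * (q * unitPt θ - (q * unitPt θ)⁻¹) *
      ((1 - (q * unitPt θ ^ 2)⁻¹) * (1 - (unitPt θ)⁻¹ ^ 2)) =
      (q : ℂ) ^ j * unitPt θ ^ (j - 2) * (unitPt θ - (unitPt θ)⁻¹) *
        ((1 - q * unitPt θ ^ 2) * (1 - (q * unitPt θ) ^ 2)) := by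
    rw [mul_zpow, zpow_add₀ hq, zpow_add₀ hz, zpow_sub₀ hz]
    simp only [zpow_ofNat]
    field_simp
    ring
  have h1 := hne ha
  have h2 := hne hb
  have h3 := hne hc
  have h4 := hne hd
  rw [shiftPhi, circleG, hrec a, hrec b, hrec c, hrec d, hinv, hinv, hinv, hinv, h5, h6]
  generalize (1 - a * unitPt θ) = x1 at *
  generalize (1 - b * unitPt θ) = x2 at *
  generalize (1 - c * unitPt θ) = x3 at *
  generalize (1 - d * unitPt θ) = x4 at *
  have : x1 * x2 * x3 * x4 * (x1 * x2 * x3 * x4)⁻¹ = 1 :=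
    mul_inv_cancel₀ (by simp [h1, h2, h3, h4])
  simp only [div_eq_mul_inv]
  generalize qPochInf (↑q * (↑q * unitPt θ) ^ 2) ↑q = v1
  generalize qPochInf (↑q * (unitPt θ)⁻¹ ^ 2) ↑q = v2
  generalize (q * unitPt θ) ^ (j + 2) * (q * unitPt θ - (q * unitPt θ)⁻¹) = y1 at *
  generalize (1 - (q * unitPt θ ^ 2)⁻¹) = y2 at *
  generalize (1 - (unitPt θ)⁻¹ ^ 2) = y3 at *
  generalize (1 - q * unitPt θ ^ 2) = y4 at *
  generalize (1 - (q * unitPt θ) ^ 2) = y5 at *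
  generalize unitPt θ ^ (j - 2) = y6 at *
  generalize unitPt θ - (unitPt θ)⁻¹ = y7 at *
  generalize (q : ℂ) ^ j = y8 at *
  simp only [mul_inv] at this ⊢
  generalize (qPochInf (a * (q * unitPt θ)) (q : ℂ))⁻¹ = u1
  generalize (qPochInf (b * (q * unitPt θ)) (q : ℂ))⁻¹ = u2
  generalize (qPochInf (c * (q * unitPt θ)) (q : ℂ))⁻¹ = u3
  generalize (qPochInf (d * (q * unitPt θ)) (q : ℂ))⁻¹ = u4
  generalize (qPochInf (a * (unitPt θ)⁻¹) (q : ℂ))⁻¹ = t1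
  generalize (qPochInf (b * (unitPt θ)⁻¹) (q : ℂ))⁻¹ = t2
  generalize (qPochInf (c * (unitPt θ)⁻¹) (q : ℂ))⁻¹ = t3
  generalize (qPochInf (d * (unitPt θ)⁻¹) (q : ℂ))⁻¹ = t4
  linear_combination (v1 * v2 * (u1 * t1) * (u2 * t2) * (u3 * t3) * (u4 * t4)) * h7 -
    (y8 * y6 * y7 * y4 * y5 * v1 * v2 * (u1 * t1) * (u2 * t2) * (u3 * t3) * (u4 * t4)) * this

/-- The Laurent moments of the antisymmetrized weight on the unit circle. -/
def circleMoment (q : ℝ) (a b c d : ℂ) (j : ℤ) : ℂ :=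
  ∫ θ in (0 : ℝ)..2 * Real.pi,
    unitPt θ ^ j * ((unitPt θ - (unitPt θ)⁻¹) * circleG q a b c d (unitPt θ))

theorem continuous_moment_integrand {q : ℝ} (hq0 : 0 < q) (hq1 : q < 1) {a b c d : ℂ}
    (ha : ‖a‖ < 1) (hb : ‖b‖ < 1) (hc : ‖c‖ < 1) (hd : ‖d‖ < 1) (j : ℤ) :
    Continuous fun θ =>
      unitPt θ ^ j * ((unitPt θ - (unitPt θ)⁻¹) * circleG q a b c d (unitPt θ)) :=
  (continuous_unitPt.zpow₀ j fun θ => Or.inl (unitPt_ne_zero θ)).mul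
    ((continuous_unitPt.sub continuous_unitPt_inv).mul (continuous_circleG hq0 hq1 ha hb hc hd))

theorem circleMoment_neg (q : ℝ) (a b c d : ℂ) (j : ℤ) :
    circleMoment q a b c d (-j) = -circleMoment q a b c d j := by
  have h := intervalIntegral.integral_comp_sub_left (a := 0) (b := 2 * Real.pi)
    (fun θ => unitPt θ ^ j * ((unitPt θ - (unitPt θ)⁻¹) * circleG q a b c d (unitPt θ)))
    (2 * Real.pi)
  rw [sub_self, sub_zero] at h
  rw [circleMoment, circleMoment, ← h, ← intervalIntegral.integral_neg]
  refine intervalIntegral.integral_congr fun θ _ => ?_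
  simp only [unitPt_two_pi_sub, circleG_inv, inv_inv, zpow_neg, inv_zpow]
  ring

theorem circleMoment_recurrence {q : ℝ} (hq0 : 0 < q) (hq1 : q < 1) {a b c d : ℂ}
    (ha : ‖a‖ < 1) (hb : ‖b‖ < 1) (hc : ‖c‖ < 1) (hd : ‖d‖ < 1) (j : ℤ) :
    let M := circleMoment q a b c d
    let e1 := a + b + c + d
    let e2 := a * b + a * c + a * d + b * c + b * d + c * d
    let e3 := a * b * c + a * b * d + a * c * d + b * c * d
    let e4 := a * b * c * d
    M (j + 2) - e1 * M (j + 1) + e2 * M j - e3 * M (j - 1) + e4 * M (j - 2) =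
      (q : ℂ) ^ j *
        (M (j - 2) - e1 * M (j - 1) + e2 * M j - e3 * M (j + 1) + e4 * M (j + 2)) := by
  intro M e1 e2 e3 e4
  have hexp : ∀ c0 c1 c2 c3 c4 : ℂ, ∫ θ in (0 : ℝ)..2 * Real.pi,
      (c0 * unitPt θ ^ (j + 2) + c1 * unitPt θ ^ (j + 1) + c2 * unitPt θ ^ j +
        c3 * unitPt θ ^ (j - 1) + c4 * unitPt θ ^ (j - 2)) *
      ((unitPt θ - (unitPt θ)⁻¹) * circleG q a b c d (unitPt θ)) =
      c0 * M (j + 2) + c1 * M (j + 1) + c2 * M j + c3 * M (j - 1) + c4 * M (j - 2) := by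
    intro c0 c1 c2 c3 c4
    obtain ⟨F, hF, hFc⟩ : ∃ F : ℤ → ℝ → ℂ, (∀ i θ, F i θ =
        unitPt θ ^ i * ((unitPt θ - (unitPt θ)⁻¹) * circleG q a b c d (unitPt θ))) ∧
        ∀ i, Continuous (F i) :=
      ⟨_, fun _ _ => rfl, continuous_moment_integrand hq0 hq1 ha hb hc hd⟩
    have hi : ∀ (i : ℤ) (k : ℂ), IntervalIntegrable (fun θ => k * F i θ) MeasureTheory.volume
      0 (2 * Real.pi) := fun i k => (continuous_const.mul (hFc i)).intervalIntegrable _ _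
    simp only [M, circleMoment, ← hF, ← intervalIntegral.integral_const_mul]
    rw [← intervalIntegral.integral_add, ← intervalIntegral.integral_add,
      ← intervalIntegral.integral_add, ← intervalIntegral.integral_add]
    · refine intervalIntegral.integral_congr fun θ _ => ?_
      simp only [hF]
      ring
    all_goals exact Continuous.intervalIntegrable (by fun_prop) _ _
  have key := integral_shiftPhi hq0 hq1 ha hb hc hd j
  simp only [shiftPhi_unitPt hq0 hq1 ha hb hc hd, shiftPhi_mul_unitPt hq0 hq1 ha hb hc hd,
    intervalIntegral.integral_const_mul] at key
  have hl : ∀ θ, unitPt θ ^ (j + 2) * ((1 - a * (unitPt θ)⁻¹) * (1 - b * (unitPt θ)⁻¹) *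
        (1 - c * (unitPt θ)⁻¹) * (1 - d * (unitPt θ)⁻¹)) =
      1 * unitPt θ ^ (j + 2) + -e1 * unitPt θ ^ (j + 1) + e2 * unitPt θ ^ j +
        -e3 * unitPt θ ^ (j - 1) + e4 * unitPt θ ^ (j - 2) := by
    intro θ
    have hz := unitPt_ne_zero θ
    simp only [zpow_add₀ hz, zpow_sub₀ hz, zpow_ofNat, e1, e2, e3, e4]
    field_simp
    ring
  have hr : ∀ θ, unitPt θ ^ (j - 2) * ((1 - a * unitPt θ) * (1 - b * unitPt θ) *
        (1 - c * unitPt θ) * (1 - d * unitPt θ)) =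
      e4 * unitPt θ ^ (j + 2) + -e3 * unitPt θ ^ (j + 1) + e2 * unitPt θ ^ j +
        -e1 * unitPt θ ^ (j - 1) + 1 * unitPt θ ^ (j - 2) := by
    intro θ
    have hz := unitPt_ne_zero θ
    simp only [zpow_add₀ hz, zpow_sub₀ hz, zpow_ofNat, e1, e2, e3, e4]
    field_simp
    ring
  simp only [hl, hr, hexp] at key
  linear_combination key

/-- Since $U_{j-1}(\cos\theta)\sin\theta=\sin j\theta$, the factor $\sin^2\theta\,U_{j-1}$ equals
$-\tfrac14(z^j-z^{-j})(z-z^{-1})$; the two resulting moments agree up to sign. -/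
theorem circleFunctional_U {q : ℝ} (hq0 : 0 < q) (hq1 : q < 1) {a b c d : ℂ}
    (ha : ‖a‖ < 1) (hb : ‖b‖ < 1) (hc : ‖c‖ < 1) (hd : ‖d‖ < 1) (j : ℤ) :
    circleFunctional q a b c d (Chebyshev.U ℂ (j - 1)) = -(1 / 2) * circleMoment q a b c d j := by
  have hi := fun (i : ℤ) => Continuous.intervalIntegrable
    (μ := MeasureTheory.volume)
    (continuous_moment_integrand hq0 hq1 ha hb hc hd i) 0 (2 * Real.pi)
  have h : circleFunctional q a b c d (Chebyshev.U ℂ (j - 1)) =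
      -(1 / 4) * (circleMoment q a b c d j - circleMoment q a b c d (-j)) := by
    rw [circleFunctional, circleMoment, circleMoment, ← intervalIntegral.integral_sub (hi _) (hi _),
      ← intervalIntegral.integral_const_mul]
    refine intervalIntegral.integral_congr fun θ _ => ?_
    have hU := Chebyshev.U_complex_cos (θ : ℂ) (j - 1)
    have hj : Complex.sin (((j - 1 : ℤ) + 1) * θ) =
        (unitPt θ ^ (-j) - unitPt θ ^ j) * Complex.I / 2 := by
      simp only [unitPt, ← Complex.exp_int_mul, Complex.sin]
      push_cast
      ring_nf
    have hs := sin_eq_unitPt θ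
    simp only [circleIntegrand]
    rw [hj] at hU
    push_cast at hs ⊢
    rw [sq, ← mul_assoc, ← mul_assoc, hU, hs]
    linear_combination (1 / 4) * (unitPt θ ^ (-j) - unitPt θ ^ j) *
      ((unitPt θ)⁻¹ - unitPt θ) * circleG q a b c d (unitPt θ) * Complex.I_sq
  rw [h, circleMoment_neg]
  ring

/-! ### Dependence on the parameter $a$: the shift $a\mapsto aq^k$ and the total mass. -/

/-- `circleFunctional` as a linear map. -/
def circleLin {q : ℝ} (hq0 : 0 < q) (hq1 : q < 1) {a b c d : ℂ}
    (ha : ‖a‖ < 1) (hb : ‖b‖ < 1) (hc : ‖c‖ < 1) (hd : ‖d‖ < 1) : ℂ[X] →ₗ[ℂ] ℂ where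
  toFun := circleFunctional q a b c d
  map_add' p r := by
    have hp := continuous_circleIntegrand hq0 hq1 ha hb hc hd p
    have hr := continuous_circleIntegrand hq0 hq1 ha hb hc hd r
    rw [circleFunctional, circleFunctional, circleFunctional, ← intervalIntegral.integral_add
      (hp.intervalIntegrable _ _) (hr.intervalIntegrable _ _)]
    simp only [circleIntegrand, eval_add, add_mul]
  map_smul' k p := by
    simp only [circleFunctional, circleIntegrand, eval_smul, smul_eq_mul, RingHom.id_apply,
      ← intervalIntegral.integral_const_mul, mul_assoc]

theorem circleLin_apply {q : ℝ} (hq0 : 0 < q) (hq1 : q < 1) {a b c d : ℂ}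
    (ha : ‖a‖ < 1) (hb : ‖b‖ < 1) (hc : ‖c‖ < 1) (hd : ‖d‖ < 1) (p : ℂ[X]) :
    circleLin hq0 hq1 ha hb hc hd p = circleFunctional q a b c d p := rfl

theorem norm_mul_pow_lt_one {q : ℝ} (hq0 : 0 < q) (hq1 : q < 1) {a : ℂ} (ha : ‖a‖ < 1) (k : ℕ) :
    ‖a * (q : ℂ) ^ k‖ < 1 := (norm_mul_ofReal_pow_le hq0 hq1 a k).trans_lt ha

theorem norm_mul_lt_one {a b : ℂ} (ha : ‖a‖ < 1) (hb : ‖b‖ < 1) : ‖a * b‖ < 1 := by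
  rw [norm_mul]
  exact mul_lt_one_of_nonneg_of_lt_one_left (norm_nonneg _) ha hb.le

/-- On the circle $1-2ax+a^2=(1-az)(1-a/z)$, which removes the first factors of $(az,a/z;q)_\infty$
from the denominator. -/
theorem circleFunctional_mul_q {q : ℝ} (hq0 : 0 < q) (hq1 : q < 1) {a : ℂ} (ha : ‖a‖ < 1)
    (b c d : ℂ) (p : ℂ[X]) :
    circleFunctional q (a * q) b c d p =
      circleFunctional q a b c d ((1 - C (2 * a) * X + C (a ^ 2)) * p) := by
  refine intervalIntegral.integral_congr fun θ _ => ?_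
  have hz := unitPt_ne_zero θ
  have hne1 : 1 - a * (unitPt θ)⁻¹ ≠ 0 :=
    one_sub_ne_zero_of_norm_lt_one (by simpa [norm_unitPt] using ha)
  have hne2 : 1 - a * unitPt θ ≠ 0 :=
    one_sub_ne_zero_of_norm_lt_one (by simpa [norm_unitPt] using ha)
  have hx : 1 - 2 * a * (Real.cos θ : ℂ) + a ^ 2 =
      (1 - a * unitPt θ) * (1 - a * (unitPt θ)⁻¹) := by
    rw [cos_eq_unitPt]
    field_simp
    ring
  have h1 : qPochInf (a * unitPt θ) q = (1 - a * unitPt θ) * qPochInf (a * q * unitPt θ) q := by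
    rw [qPochInf_eq_mul hq0 hq1, mul_right_comm]
  have h2 : qPochInf (a * (unitPt θ)⁻¹) q =
      (1 - a * (unitPt θ)⁻¹) * qPochInf (a * q * (unitPt θ)⁻¹) q := by
    rw [qPochInf_eq_mul hq0 hq1, mul_right_comm]
  simp only [circleIntegrand, eval_mul, eval_add, eval_sub, eval_one, eval_C, eval_X]
  rw [hx, circleG, circleG, h1, h2]
  generalize 1 - a * unitPt θ = x1 at *
  generalize 1 - a * (unitPt θ)⁻¹ = x2 at *
  have : x1 * x1⁻¹ * (x2 * x2⁻¹) = 1 := by rw [mul_inv_cancel₀ hne2, mul_inv_cancel₀ hne1, one_mul]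
  generalize qPochInf (a * q * unitPt θ) (q : ℂ) = u
  generalize qPochInf (a * q * (unitPt θ)⁻¹) (q : ℂ) = v
  generalize qPochInf (q * unitPt θ ^ 2) q * qPochInf (q * (unitPt θ)⁻¹ ^ 2) q = w
  generalize qPochInf (b * unitPt θ) q * qPochInf (b * (unitPt θ)⁻¹) q = y1
  generalize qPochInf (c * unitPt θ) q * qPochInf (c * (unitPt θ)⁻¹) q = y2
  generalize qPochInf (d * unitPt θ) q * qPochInf (d * (unitPt θ)⁻¹) q = y3
  simp only [div_eq_mul_inv, mul_inv]
  linear_combination (-(eval (Real.cos θ : ℂ) p * (Real.sin θ : ℂ) ^ 2 * w * u⁻¹ * v⁻¹ *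
    y1⁻¹ * y2⁻¹ * y3⁻¹)) * this

/-- The basis polynomials `(a z, a / z; q)_k`. -/
def awBasis (q : ℝ) (a : ℂ) (k : ℕ) : ℂ[X] :=
  ∏ i ∈ Finset.range k, (1 - C (2 * a * (q : ℂ) ^ i) * X + C (a ^ 2 * (q : ℂ) ^ (2 * i)))

theorem circleFunctional_mul_pow {q : ℝ} (hq0 : 0 < q) (hq1 : q < 1) {a : ℂ} (ha : ‖a‖ < 1)
    (b c d : ℂ) (k : ℕ) (p : ℂ[X]) :
    circleFunctional q (a * q ^ k) b c d p = circleFunctional q a b c d (awBasis q a k * p) := by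
  induction k generalizing p with
  | zero => simp [awBasis]
  | succ k ih =>
    rw [pow_succ, ← mul_assoc, circleFunctional_mul_q hq0 hq1 (norm_mul_pow_lt_one hq0 hq1 ha k),
      ih, awBasis, awBasis, Finset.prod_range_succ, mul_assoc, mul_assoc 2, mul_pow, ← pow_mul,
      mul_comm k 2]

theorem circleFunctional_U_neg {q : ℝ} (hq0 : 0 < q) (hq1 : q < 1) {a b c d : ℂ}
    (ha : ‖a‖ < 1) (hb : ‖b‖ < 1) (hc : ‖c‖ < 1) (hd : ‖d‖ < 1) :
    circleFunctional q a b c d (Chebyshev.U ℂ (-1)) = 0 ∧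
    circleFunctional q a b c d (Chebyshev.U ℂ (-2)) =
      -circleFunctional q a b c d (Chebyshev.U ℂ 0) := by
  have h0 : circleFunctional q a b c d 0 = 0 := map_zero (circleLin hq0 hq1 ha hb hc hd)
  have h1 := map_neg (circleLin hq0 hq1 ha hb hc hd) 1
  simp only [circleLin_apply] at h1
  constructor
  · simpa using h0
  · simpa using h1

/-- Recurrence for the moments `⟨u, U_n⟩` against Chebyshev polynomials. -/
theorem circleFunctional_U_recurrence {q : ℝ} (hq0 : 0 < q) (hq1 : q < 1) {a b c d : ℂ}
    (ha : ‖a‖ < 1) (hb : ‖b‖ < 1) (hc : ‖c‖ < 1) (hd : ‖d‖ < 1) (m : ℕ) :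
    let w := fun i : ℤ => circleFunctional q a b c d (Chebyshev.U ℂ i)
    let e1 := a + b + c + d
    let e2 := a * b + a * c + a * d + b * c + b * d + c * d
    let e3 := a * b * c + a * b * d + a * c * d + b * c * d
    let e4 := a * b * c * d
    (1 - e4 * q ^ m) * w (m + 1) = (e1 - e3 * q ^ m) * w m - e2 * (1 - q ^ m) * w (m - 1) +
      (e3 - e1 * q ^ m) * w (m - 2) - (e4 - q ^ m) * w (m - 3) := by
  intro w e1 e2 e3 e4
  have h := circleMoment_recurrence hq0 hq1 ha hb hc hd m
  have hU := circleFunctional_U hq0 hq1 ha hb hc hd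
  have hw : ∀ i : ℤ, circleMoment q a b c d i = -2 * w (i - 1) := fun i => by
    simp only [w, hU]; ring
  simp only [hw, zpow_natCast] at h
  rw [show (m : ℤ) + 2 - 1 = m + 1 by ring, show (m : ℤ) + 1 - 1 = m by ring,
    show (m : ℤ) - 1 - 1 = m - 2 by ring, show (m : ℤ) - 2 - 1 = m - 3 by ring] at h
  linear_combination (-1 / 2) * h

/-- At $m=0$ the reflections $U_{-2}=-U_0$ and $U_{-3}=-U_1$ fold the recurrence into a two-term
relation, each side doubled. -/
theorem circleFunctional_U_one {q : ℝ} (hq0 : 0 < q) (hq1 : q < 1) {a b c d : ℂ}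
    (ha : ‖a‖ < 1) (hb : ‖b‖ < 1) (hc : ‖c‖ < 1) (hd : ‖d‖ < 1) :
    (1 - a * b * c * d) * circleFunctional q a b c d (Chebyshev.U ℂ 1) =
      (a + b + c + d - (a * b * c + a * b * d + a * c * d + b * c * d)) *
        circleFunctional q a b c d (Chebyshev.U ℂ 0) := by
  have hM := circleMoment_neg q a b c d 2
  have hU := circleFunctional_U hq0 hq1 ha hb hc hd
  have h2 := (circleFunctional_U_neg hq0 hq1 ha hb hc hd).2
  have h3 : circleFunctional q a b c d (Chebyshev.U ℂ (-3)) =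
      -circleFunctional q a b c d (Chebyshev.U ℂ 1) := by
    have e1 := hU 2
    have e2 := hU (-2)
    rw [show (2 : ℤ) - 1 = 1 by norm_num] at e1
    rw [show (-2 : ℤ) - 1 = -3 by norm_num] at e2
    rw [e1, e2, hM]
    ring
  have h := circleFunctional_U_recurrence hq0 hq1 ha hb hc hd 0
  simp only [Nat.cast_zero, zero_add, zero_sub, pow_zero, mul_one] at h
  rw [h2, h3] at h
  linear_combination (1 / 2) * h

/-- Write $1-2aX+a^2=(1+a^2)U_0-aU_1$ and eliminate $U_1$. Iteration gives the mass ratios without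
knowing any mass. -/
theorem circleFunctional_one_mul_q {q : ℝ} (hq0 : 0 < q) (hq1 : q < 1) {a b c d : ℂ}
    (ha : ‖a‖ < 1) (hb : ‖b‖ < 1) (hc : ‖c‖ < 1) (hd : ‖d‖ < 1) :
    (1 - a * b * c * d) * circleFunctional q (a * q) b c d 1 =
      (1 - a * b) * (1 - a * c) * (1 - a * d) * circleFunctional q a b c d 1 := by
  have h := circleFunctional_U_one hq0 hq1 ha hb hc hd
  rw [Chebyshev.U_zero] at h
  have hp : (1 - C (2 * a) * X + C (a ^ 2)) * 1 =
      (1 + a ^ 2) • (1 : ℂ[X]) - a • Chebyshev.U ℂ 1 := by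
    rw [Chebyshev.U_one]
    simp only [smul_eq_C_mul, C_add, C_mul, C_pow, C_1, C_ofNat]
    ring
  rw [circleFunctional_mul_q hq0 hq1 ha, hp, ← circleLin_apply hq0 hq1 ha hb hc hd, map_sub,
    map_smul, map_smul, circleLin_apply, circleLin_apply, smul_eq_mul, smul_eq_mul]
  linear_combination (-a) * h

theorem circleFunctional_one_mul_pow {q : ℝ} (hq0 : 0 < q) (hq1 : q < 1) {a b c d : ℂ}
    (ha : ‖a‖ < 1) (hb : ‖b‖ < 1) (hc : ‖c‖ < 1) (hd : ‖d‖ < 1) (k : ℕ) :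
    qPoch (a * b * c * d) q k * circleFunctional q (a * q ^ k) b c d 1 =
      qPoch (a * b) q k * qPoch (a * c) q k * qPoch (a * d) q k * circleFunctional q a b c d 1 := by
  induction k with
  | zero => simp [qPoch]
  | succ k ih =>
    have h := circleFunctional_one_mul_q hq0 hq1 (norm_mul_pow_lt_one hq0 hq1 ha k) hb hc hd
    rw [pow_succ, ← mul_assoc]
    simp only [qPoch_succ]
    linear_combination (qPoch (a * b * c * d) q k) * h +
      (1 - a * q ^ k * b) * (1 - a * q ^ k * c) * (1 - a * q ^ k * d) * ih

/-! ### Functional values as rational functions of $q^k$. -/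

/-- `w k` is, up to the factor `(e q^k; q)_m`, a polynomial of degree at most `m` in `q^k` times
`v k`. -/
def IsQRational (q e : ℂ) (v : ℕ → ℂ) (m : ℕ) (w : ℕ → ℂ) : Prop :=
  ∃ r : ℂ[X], r.natDegree ≤ m ∧ ∀ k, qPoch (e * q ^ k) q m * w k = r.eval (q ^ k) * v k

namespace IsQRational

variable {q e : ℂ} {v : ℕ → ℂ} {m n : ℕ} {w w₁ w₂ w₃ w₄ : ℕ → ℂ}

theorem zero : IsQRational q e v m fun _ => 0 := ⟨0, by simp, by simp⟩

theorem add (h₁ : IsQRational q e v m w₁) (h₂ : IsQRational q e v m w₂) :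
    IsQRational q e v m fun k => w₁ k + w₂ k := by
  obtain ⟨r₁, hr₁, h₁⟩ := h₁
  obtain ⟨r₂, hr₂, h₂⟩ := h₂
  refine ⟨r₁ + r₂, natDegree_add_le_of_degree_le hr₁ hr₂, fun k => ?_⟩
  rw [eval_add, mul_add, h₁, h₂, add_mul]

theorem const_mul (t : ℂ) (h : IsQRational q e v m w) :
    IsQRational q e v m fun k => t * w k := by
  obtain ⟨r, hr, h⟩ := h
  refine ⟨C t * r, (natDegree_C_mul_le _ _).trans hr, fun k => ?_⟩
  rw [eval_mul, eval_C, mul_left_comm, h, mul_assoc]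

theorem succ (h : IsQRational q e v m w) : IsQRational q e v (m + 1) w := by
  obtain ⟨r, hr, h⟩ := h
  refine ⟨r * (C (-(e * q ^ m)) * X + C 1),
    natDegree_mul_le_of_le hr natDegree_linear_le, fun k => ?_⟩
  rw [qPoch_succ]
  simp only [eval_mul, eval_add, eval_C, eval_X]
  linear_combination (1 - e * q ^ k * q ^ m) * h k

theorem mono (hmn : m ≤ n) (h : IsQRational q e v m w) : IsQRational q e v n w := by
  induction n, hmn using Nat.le_induction with
  | base => exact h
  | succ n _ ih => exact ih.succ

/-- Models one use of the recurrence: affine coefficients in $q^k$ raise the degree by one, and the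
leading coefficient extends the denominator by one factor. -/
theorem step (α₁ β₁ α₂ β₂ α₃ β₃ α₄ β₄ : ℂ) (h₁ : IsQRational q e v m w₁)
    (h₂ : IsQRational q e v m w₂) (h₃ : IsQRational q e v m w₃) (h₄ : IsQRational q e v m w₄)
    (h : ∀ k, (1 - e * q ^ k * q ^ m) * w k = (α₁ * q ^ k + β₁) * w₁ k + (α₂ * q ^ k + β₂) * w₂ k +
      (α₃ * q ^ k + β₃) * w₃ k + (α₄ * q ^ k + β₄) * w₄ k) : IsQRational q e v (m + 1) w := by
  obtain ⟨r₁, hr₁, h₁⟩ := h₁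
  obtain ⟨r₂, hr₂, h₂⟩ := h₂
  obtain ⟨r₃, hr₃, h₃⟩ := h₃
  obtain ⟨r₄, hr₄, h₄⟩ := h₄
  have hdeg : ∀ {r : ℂ[X]} (α β : ℂ), r.natDegree ≤ m → (r * (C α * X + C β)).natDegree ≤ m + 1 :=
    fun α β hr => natDegree_mul_le_of_le hr natDegree_linear_le
  refine ⟨r₁ * (C α₁ * X + C β₁) + r₂ * (C α₂ * X + C β₂) + r₃ * (C α₃ * X + C β₃) +
    r₄ * (C α₄ * X + C β₄), natDegree_add_le_of_degree_le (natDegree_add_le_of_degree_le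
      (natDegree_add_le_of_degree_le (hdeg _ _ hr₁) (hdeg _ _ hr₂)) (hdeg _ _ hr₃))
      (hdeg _ _ hr₄), fun k => ?_⟩
  rw [qPoch_succ]
  simp only [eval_mul, eval_add, eval_C, eval_X]
  linear_combination (qPoch (e * q ^ k) q m) * h k + (α₁ * q ^ k + β₁) * h₁ k +
    (α₂ * q ^ k + β₂) * h₂ k + (α₃ * q ^ k + β₃) * h₃ k + (α₄ * q ^ k + β₄) * h₄ k

end IsQRational

/-- The elementary symmetric functions of $aq^k,b,c,d$ are affine in $q^k$, so every coefficient of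
the recurrence for $U_{m+1}$ is too. Induction on the degree then applies. -/
theorem isQRational_U {q : ℝ} (hq0 : 0 < q) (hq1 : q < 1) {a b c d : ℂ}
    (ha : ‖a‖ < 1) (hb : ‖b‖ < 1) (hc : ‖c‖ < 1) (hd : ‖d‖ < 1) (n : ℕ) :
    IsQRational q (a * b * c * d) (fun k => circleFunctional q (a * q ^ k) b c d 1) n
      (fun k => circleFunctional q (a * q ^ k) b c d (Chebyshev.U ℂ n)) := by
  induction n using Nat.strong_induction_on with
  | _ n ih =>
  match n with
  | 0 => exact ⟨1, by simp, fun k => by simp [qPoch]⟩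
  | m + 1 =>
    have hk := fun k => norm_mul_pow_lt_one hq0 hq1 ha k
    have hneg := fun k => circleFunctional_U_neg hq0 hq1 (hk k) hb hc hd
    have H : ∀ i : ℤ, -2 ≤ i → i ≤ m →
        IsQRational q (a * b * c * d) (fun k => circleFunctional q (a * q ^ k) b c d 1) m
          (fun k => circleFunctional q (a * q ^ k) b c d (Chebyshev.U ℂ i)) := by
      intro i hi him
      obtain rfl | rfl | h0 : i = -2 ∨ i = -1 ∨ 0 ≤ i := by omega
      · simp only [(hneg _).2]
        simpa only [neg_one_mul, Nat.cast_zero] using ((ih 0 (by omega)).const_mul (-1)).mono (Nat.zero_le m)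
      · simp only [(hneg _).1]
        exact .zero
      · lift i to ℕ using h0
        exact (ih i (by omega)).mono (by omega)
    -- For $m=0$ the recurrence would reach $U_{-3}$, outside the range of `H`; the folded relation
    -- is used instead.
    obtain rfl | hm := Nat.eq_zero_or_pos m
    · refine IsQRational.step (a - a * (b * c + b * d + c * d)) (b + c + d - b * c * d) 0 0 0 0 0 0
        (H 0 (by omega) (by omega)) .zero .zero .zero fun k => ?_
      have h := circleFunctional_U_one hq0 hq1 (hk k) hb hc hd
      norm_num at h ⊢
      linear_combination h
    · refine IsQRational.step
        (a - a * (b * c + b * d + c * d) * q ^ m) (b + c + d - b * c * d * q ^ m)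
        (-(a * (b + c + d)) * (1 - q ^ m)) (-(b * c + b * d + c * d) * (1 - q ^ m))
        (a * (b * c + b * d + c * d) - a * q ^ m) (b * c * d - (b + c + d) * q ^ m)
        (-(a * b * c * d)) (q ^ m)
        (H m (by omega) (by omega)) (H (m - 1) (by omega) (by omega))
        (H (m - 2) (by omega) (by omega)) (H (m - 3) (by omega) (by omega)) fun k => ?_
      have h := circleFunctional_U_recurrence hq0 hq1 (hk k) hb hc hd m
      simp only at h
      push_cast
      linear_combination h

theorem isQRational_of_natDegree_le {q : ℝ} (hq0 : 0 < q) (hq1 : q < 1) {a b c d : ℂ}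
    (ha : ‖a‖ < 1) (hb : ‖b‖ < 1) (hc : ‖c‖ < 1) (hd : ‖d‖ < 1) (m : ℕ) (p : ℂ[X])
    (hp : p.natDegree ≤ m) :
    IsQRational q (a * b * c * d) (fun k => circleFunctional q (a * q ^ k) b c d 1) m
      (fun k => circleFunctional q (a * q ^ k) b c d p) := by
  have hk := fun k => norm_mul_pow_lt_one hq0 hq1 ha k
  let S : Polynomial.Sequence ℂ := ⟨fun n => Chebyshev.U ℂ n, Chebyshev.degree_U_natCast ℂ⟩
  have hspan : p ∈ Submodule.span ℂ (S '' Set.Iic m) := by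
    rw [S.span_degreeLE fun i _ => (leadingCoeff_ne_zero.2 (S.ne_zero i)).isUnit, mem_degreeLE]
    exact natDegree_le_iff_degree_le.1 hp
  clear hp
  induction hspan using Submodule.span_induction with
  | mem x hx =>
    obtain ⟨i, hi, rfl⟩ := hx
    exact (isQRational_U hq0 hq1 ha hb hc hd i).mono hi
  | zero =>
    simp only [← circleLin_apply hq0 hq1 (hk _) hb hc hd, map_zero]
    exact .zero
  | add x y _ _ hx hy =>
    simp only [← circleLin_apply hq0 hq1 (hk _) hb hc hd, map_add] at hx hy ⊢
    exact hx.add hy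
  | smul t x _ hx =>
    simp only [← circleLin_apply hq0 hq1 (hk _) hb hc hd, map_smul, smul_eq_mul] at hx ⊢
    exact hx.const_mul t

/-! ### The terminating $q$-binomial theorem and orthogonality of the Askey–Wilson polynomials. -/

theorem qPoch_succ' (z q : ℂ) (n : ℕ) : qPoch z q (n + 1) = (1 - z) * qPoch (z * q) q n := by
  rw [add_comm, qPoch_add]
  simp [qPoch]

theorem zpow_neg_succ_mul {q : ℂ} (hq : q ≠ 0) (n : ℕ) :
    q ^ (-((n + 1 : ℕ) : ℤ)) * q = q ^ (-(n : ℤ)) := by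
  rw [← zpow_add_one₀ hq]
  congr 1
  push_cast
  ring

/-- The terminating `q`-binomial theorem, in the form of its vanishing at `q, q², …, qⁿ`. -/
theorem sum_qPoch_neg_eq_prod {q : ℝ} (hq0 : 0 < q) (hq1 : q < 1) (n : ℕ) (t : ℂ) :
    ∑ k ∈ Finset.range (n + 1), qPoch ((q : ℂ) ^ (-(n : ℤ))) q k / qPoch q q k * t ^ k =
      ∏ i ∈ Finset.range n, (1 - t * (q : ℂ) ^ (-((i + 1 : ℕ) : ℤ))) := by
  have hq : (q : ℂ) ≠ 0 := by exact_mod_cast hq0.ne'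
  have hqn : ‖(q : ℂ)‖ < 1 := by simpa [abs_of_pos hq0] using hq1
  induction n with
  | zero => simp [qPoch]
  | succ n ih =>
    rw [Finset.prod_range_succ, ← ih]
    -- A $q$-Pascal rule: with $y=q^{-n-1}$ it reduces to $(1-y)-(1-yq^{k+1})=-y(1-q^{k+1})$.
    have hterm : ∀ k, qPoch ((q : ℂ) ^ (-((n + 1 : ℕ) : ℤ))) q (k + 1) / qPoch q q (k + 1) *
        t ^ (k + 1) =
        qPoch ((q : ℂ) ^ (-(n : ℤ))) q (k + 1) / qPoch q q (k + 1) * t ^ (k + 1) -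
        (q : ℂ) ^ (-((n + 1 : ℕ) : ℤ)) * t *
          (qPoch ((q : ℂ) ^ (-(n : ℤ))) q k / qPoch q q k * t ^ k) := by
      intro k
      have h1 : (1 : ℂ) - q * q ^ k ≠ 0 := one_sub_ne_zero_of_norm_lt_one
        ((norm_mul_ofReal_pow_le hq0 hq1 _ k).trans_lt hqn)
      have h2 := qPoch_ne_zero hq0 hq1 hqn k
      rw [qPoch_succ', zpow_neg_succ_mul hq, qPoch_succ, qPoch_succ, ← zpow_neg_succ_mul hq n]
      generalize (q : ℂ) ^ (-((n + 1 : ℕ) : ℤ)) = y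
      field_simp
      ring
    rw [Finset.sum_range_succ', Finset.sum_congr rfl fun k _ => hterm k, Finset.sum_sub_distrib,
      ← Finset.mul_sum, sub_add_eq_add_sub]
    have h0 := Finset.sum_range_succ' (fun k => qPoch ((q : ℂ) ^ (-(n : ℤ))) q k / qPoch q q k *
      t ^ k) (n + 1)
    rw [Finset.sum_range_succ, qPoch_neg_pow_eq_zero q hq0 n (n + 1) (Nat.lt_succ_self n)] at h0
    simp only [qPoch, Finset.prod_range_zero, zero_div, zero_mul, add_zero] at h0 ⊢
    rw [← h0]
    ring

/-- For each monomial of degree $j<n$, take $t=q^{j+1}$ in the $q$-binomial product: its factor of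
index $j$ is zero. -/
theorem sum_qPoch_neg_mul_eval_eq_zero {q : ℝ} (hq0 : 0 < q) (hq1 : q < 1) (n : ℕ) (r : ℂ[X])
    (hr : r.natDegree < n) :
    ∑ k ∈ Finset.range (n + 1), qPoch ((q : ℂ) ^ (-(n : ℤ))) q k / qPoch q q k * (q : ℂ) ^ k *
      r.eval ((q : ℂ) ^ k) = 0 := by
  have hq : (q : ℂ) ≠ 0 := by exact_mod_cast hq0.ne'
  simp only [eval_eq_sum_range, Finset.mul_sum]
  rw [Finset.sum_comm]
  refine Finset.sum_eq_zero fun j hj => ?_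
  have h := sum_qPoch_neg_eq_prod hq0 hq1 n ((q : ℂ) ^ (j + 1))
  rw [Finset.prod_eq_zero (i := j)
    (Finset.mem_range.2 ((Finset.mem_range_succ_iff.1 hj).trans_lt hr))] at h
  · rw [← mul_zero (r.coeff j), ← h, Finset.mul_sum]
    refine Finset.sum_congr rfl fun k _ => ?_
    rw [← pow_mul, ← pow_mul, add_mul, one_mul, pow_add, mul_comm k j]
    ring
  · rw [zpow_neg, zpow_natCast, mul_inv_cancel₀ (pow_ne_zero _ hq), sub_self]

theorem natDegree_awBasis_le (q : ℝ) (a : ℂ) (k : ℕ) : (awBasis q a k).natDegree ≤ k := by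
  refine (natDegree_prod_le _ _).trans ((Finset.sum_le_card_nsmul _ _ 1 fun i _ => ?_).trans ?_)
  · have : (1 : ℂ[X]) - C (2 * a * (q : ℂ) ^ i) * X + C (a ^ 2 * (q : ℂ) ^ (2 * i)) =
        C (-(2 * a * (q : ℂ) ^ i)) * X + C (1 + a ^ 2 * (q : ℂ) ^ (2 * i)) := by
      simp only [C_neg, C_add, C_1]
      ring
    rw [this]
    exact natDegree_linear_le
  · simp

theorem coeff_awBasis (q : ℝ) (a : ℂ) (k : ℕ) :
    (awBasis q a k).coeff k = ∏ i ∈ Finset.range k, -(2 * a * (q : ℂ) ^ i) := by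
  induction k with
  | zero => simp [awBasis]
  | succ k ih =>
    have hs : awBasis q a (k + 1) =
        awBasis q a k * (C (-(2 * a * (q : ℂ) ^ k)) * X + C (1 + a ^ 2 * (q : ℂ) ^ (2 * k))) := by
      rw [awBasis, awBasis, Finset.prod_range_succ]
      simp only [C_neg, C_add, C_1]
      ring
    rw [hs, coeff_mul_add_eq_of_natDegree_le (natDegree_awBasis_le q a k) natDegree_linear_le, ih,
      Finset.prod_range_succ, coeff_add, coeff_C_mul, coeff_X_one, coeff_C_of_ne_zero one_ne_zero,
      mul_one, add_zero]

theorem qPoch_neg_self {q : ℝ} (hq0 : 0 < q) (n : ℕ) :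
    qPoch ((q : ℂ) ^ (-(n : ℤ))) q n * q ^ n * ∏ i ∈ Finset.range n, -(q : ℂ) ^ i = qPoch q q n := by
  have hq : (q : ℂ) ≠ 0 := by exact_mod_cast hq0.ne'
  induction n with
  | zero => simp [qPoch]
  | succ n ih =>
    rw [qPoch_succ', zpow_neg_succ_mul hq, Finset.prod_range_succ, qPoch_succ q q n, ← ih,
      zpow_neg, zpow_natCast]
    field_simp
    ring

theorem awPoly_eq (q : ℝ) (a b c d : ℂ) (n : ℕ) :
    awPoly q a b c d n = ∑ k ∈ Finset.range (n + 1),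
      C (awPrefactor q a b c d n * (qPoch ((q : ℂ) ^ (-(n : ℤ))) q k *
        qPoch (a * b * c * d * (q : ℂ) ^ ((n : ℤ) - 1)) q k /
          (qPoch (a * b) q k * qPoch (a * c) q k * qPoch (a * d) q k * qPoch q q k) *
            (q : ℂ) ^ k)) * awBasis q a k := by
  rw [awPoly, Finset.mul_sum]
  refine Finset.sum_congr rfl fun k _ => ?_
  rw [← mul_assoc, ← C_mul, awBasis]

theorem natDegree_awPoly_le (q : ℝ) (a b c d : ℂ) (n : ℕ) :
    (awPoly q a b c d n).natDegree ≤ n := by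
  rw [awPoly_eq]
  exact natDegree_sum_le_of_forall_le _ _ fun k hk => (natDegree_C_mul_le _ _).trans
    ((natDegree_awBasis_le q a k).trans (Finset.mem_range_succ_iff.1 hk))

theorem norm_four_mul_lt_one {a b c d : ℂ} (ha : ‖a‖ < 1) (hb : ‖b‖ < 1) (hc : ‖c‖ < 1)
    (hd : ‖d‖ < 1) : ‖a * b * c * d‖ < 1 :=
  norm_mul_lt_one (norm_mul_lt_one (norm_mul_lt_one ha hb) hc) hd

/-- Only the term $k=n$ reaches degree $n$, and `awPrefactor` is the reciprocal of its leading
coefficient. -/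
theorem coeff_awPoly {q : ℝ} (hq0 : 0 < q) (hq1 : q < 1) {a b c d : ℂ} (ha0 : a ≠ 0)
    (ha : ‖a‖ < 1) (hb : ‖b‖ < 1) (hc : ‖c‖ < 1) (hd : ‖d‖ < 1) (n : ℕ) :
    (awPoly q a b c d n).coeff n = 1 := by
  have hqn : ‖(q : ℂ)‖ < 1 := by simpa [abs_of_pos hq0] using hq1
  rw [awPoly_eq, finsetSum_coeff, Finset.sum_eq_single n, coeff_C_mul, coeff_awBasis, awPrefactor]
  · have he : qPoch (a * b * c * d * (q : ℂ) ^ ((n : ℤ) - 1)) q n ≠ 0 := by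
      -- At $n=0$ the argument $abcd\,q^{-1}$ need not lie in the unit disc, but the product is
      -- empty.
      cases n with
      | zero => simp [qPoch]
      | succ m =>
        refine qPoch_ne_zero hq0 hq1 ?_ _
        rw [Nat.cast_succ, add_sub_cancel_right, zpow_natCast]
        exact norm_mul_pow_lt_one hq0 hq1 (norm_four_mul_lt_one ha hb hc hd) m
    have h1 := qPoch_ne_zero hq0 hq1 (norm_mul_lt_one ha hb) n
    have h2 := qPoch_ne_zero hq0 hq1 (norm_mul_lt_one ha hc) n
    have h3 := qPoch_ne_zero hq0 hq1 (norm_mul_lt_one ha hd) n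
    have h4 := qPoch_ne_zero hq0 hq1 hqn n
    have h5 := qPoch_neg_self hq0 n
    have h6 : ∏ i ∈ Finset.range n, -(2 * a * (q : ℂ) ^ i) =
        (2 * a) ^ n * ∏ i ∈ Finset.range n, -(q : ℂ) ^ i := by
      rw [← Finset.card_range n, ← Finset.prod_const, Finset.card_range, ← Finset.prod_mul_distrib]
      exact Finset.prod_congr rfl fun i _ => by ring
    have h7 : (2 * a) ^ n ≠ 0 := pow_ne_zero _ (mul_ne_zero two_ne_zero ha0)
    rw [h6]
    generalize (2 * a) ^ n = y at *
    field_simp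
    rw [← h5]
  · intro k hk hkn
    rw [coeff_C_mul, coeff_eq_zero_of_natDegree_lt, mul_zero]
    have := Finset.mem_range_succ_iff.1 hk
    exact (natDegree_awBasis_le q a k).trans_lt (by omega)
  · simp

theorem awPoly_monic {q : ℝ} (hq0 : 0 < q) (hq1 : q < 1) {a b c d : ℂ} (ha0 : a ≠ 0)
    (ha : ‖a‖ < 1) (hb : ‖b‖ < 1) (hc : ‖c‖ < 1) (hd : ‖d‖ < 1) (n : ℕ) :
    (awPoly q a b c d n).Monic :=
  monic_of_natDegree_le_of_coeff_eq_one n (natDegree_awPoly_le q a b c d n)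
    (coeff_awPoly hq0 hq1 ha0 ha hb hc hd n)

theorem natDegree_awPoly {q : ℝ} (hq0 : 0 < q) (hq1 : q < 1) {a b c d : ℂ} (ha0 : a ≠ 0)
    (ha : ‖a‖ < 1) (hb : ‖b‖ < 1) (hc : ‖c‖ < 1) (hd : ‖d‖ < 1) (n : ℕ) :
    (awPoly q a b c d n).natDegree = n :=
  natDegree_eq_of_le_of_coeff_ne_zero (natDegree_awPoly_le q a b c d n)
    (by rw [coeff_awPoly hq0 hq1 ha0 ha hb hc hd]; exact one_ne_zero)

/-- The Askey–Wilson polynomial `P_n` is orthogonal to all polynomials of degree less than `n`. -/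
theorem circleFunctional_awPoly_mul {q : ℝ} (hq0 : 0 < q) (hq1 : q < 1) {a b c d : ℂ}
    (ha : ‖a‖ < 1) (hb : ‖b‖ < 1) (hc : ‖c‖ < 1) (hd : ‖d‖ < 1) (n : ℕ) (p : ℂ[X])
    (hp : p.natDegree < n) : circleFunctional q a b c d (awPoly q a b c d n * p) = 0 := by
  obtain ⟨m, rfl⟩ : ∃ m, n = m + 1 := ⟨n - 1, by omega⟩
  obtain ⟨r, hr, h⟩ := isQRational_of_natDegree_le hq0 hq1 ha hb hc hd m p (by omega)
  have he := norm_four_mul_lt_one ha hb hc hd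
  have hqn : ‖(q : ℂ)‖ < 1 := by simpa [abs_of_pos hq0] using hq1
  have hexp : ((m + 1 : ℕ) : ℤ) - 1 = m := by push_cast; ring
  rw [awPoly_eq, Finset.sum_mul, ← circleLin_apply hq0 hq1 ha hb hc hd, map_sum, hexp,
    zpow_natCast]
  have hz := sum_qPoch_neg_mul_eval_eq_zero hq0 hq1 (m + 1) r (by omega)
  rw [← mul_zero (awPrefactor q a b c d (m + 1) * circleFunctional q a b c d 1 /
    qPoch (a * b * c * d) q m), ← hz, Finset.mul_sum]
  refine Finset.sum_congr rfl fun k _ => ?_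
  have h0 := h k
  have h1 := circleFunctional_one_mul_pow hq0 hq1 ha hb hc hd k
  -- Both sides are $(abcd;q)_{k+m}$. This trades the $k$-dependent denominators for the constant
  -- $(abcd;q)_m$ and the factor $(abcdq^{n-1};q)_k$ present in $P_n$, where $n=m+1$.
  have h2 : qPoch (a * b * c * d) q k * qPoch (a * b * c * d * q ^ k) q m =
      qPoch (a * b * c * d) q m * qPoch (a * b * c * d * q ^ m) q k := by
    rw [← qPoch_add, ← qPoch_add, add_comm]
  rw [mul_assoc, ← smul_eq_C_mul, map_smul, circleLin_apply,
    ← circleFunctional_mul_pow hq0 hq1 ha, smul_eq_mul]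
  have n1 := qPoch_ne_zero hq0 hq1 (norm_mul_lt_one ha hb) k
  have n2 := qPoch_ne_zero hq0 hq1 (norm_mul_lt_one ha hc) k
  have n3 := qPoch_ne_zero hq0 hq1 (norm_mul_lt_one ha hd) k
  have n4 := qPoch_ne_zero hq0 hq1 hqn k
  have n5 := qPoch_ne_zero hq0 hq1 he k
  have n6 := qPoch_ne_zero hq0 hq1 he m
  have n7 := qPoch_ne_zero hq0 hq1 (norm_mul_pow_lt_one hq0 hq1 he k) m
  generalize (q : ℂ) ^ (-((m + 1 : ℕ) : ℤ)) = y at *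
  have h3 : qPoch (a * b * c * d * q ^ m) q k * circleFunctional q (a * q ^ k) b c d p *
      qPoch (a * b * c * d) q m = r.eval ((q : ℂ) ^ k) *
      (qPoch (a * b) q k * qPoch (a * c) q k * qPoch (a * d) q k *
        circleFunctional q a b c d 1) := by
    rw [← h1]
    linear_combination (qPoch (a * b * c * d) q k) * h0 -
      circleFunctional q (a * q ^ k) b c d p * h2
  field_simp
  linear_combination (awPrefactor q a b c d (m + 1) * qPoch y q k) * h3

/-! ### Positivity of the weight. -/

theorem mul_conj_pos {z : ℂ} (hz : z ≠ 0) : 0 < z * starRingEnd ℂ z := by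
  rw [Complex.mul_conj]
  exact_mod_cast Complex.normSq_pos.2 hz

/-- A conjugation-equivariant function that is positive on real points has a positive product over
every multiset that is invariant under conjugation. -/
theorem prod_map_pos_of_conj_invariant {f : ℂ → ℂ}
    (hconj : ∀ z, f (starRingEnd ℂ z) = starRingEnd ℂ (f z))
    (hne : ∀ z, ‖z‖ < 1 → f z ≠ 0) (hpos : ∀ x : ℝ, ‖(x : ℂ)‖ < 1 → 0 < f x)
    (s : Multiset ℂ) (hs : s.map (starRingEnd ℂ) = s) (hlt : ∀ z ∈ s, ‖z‖ < 1) :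
    0 < (s.map f).prod := by
  classical
  induction hn : s.card using Nat.strong_induction_on generalizing s with
  | _ n ih =>
  obtain rfl | ⟨z, hz⟩ := s.empty_or_exists_mem
  · simp
  obtain ⟨t, rfl⟩ := Multiset.exists_cons_of_mem hz
  have hz1 := hlt z hz
  have hcard : t.card + 1 = n := by rw [← hn, Multiset.card_cons]
  by_cases hreal : starRingEnd ℂ z = z
  · rw [Multiset.map_cons, hreal, Multiset.cons_inj_right] at hs
    rw [Multiset.map_cons, Multiset.prod_cons]
    refine mul_pos ?_ (ih t.card (by omega) t hs
      (fun y hy => hlt y (Multiset.mem_cons_of_mem hy)) rfl)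
    obtain ⟨x, rfl⟩ := Complex.conj_eq_iff_real.1 hreal
    exact hpos x hz1
  · have hmem : starRingEnd ℂ z ∈ t := by
      have : starRingEnd ℂ z ∈ z ::ₘ t := hs ▸ Multiset.mem_map_of_mem _ hz
      exact (Multiset.mem_cons.1 this).resolve_left hreal
    obtain ⟨u, rfl⟩ := Multiset.exists_cons_of_mem hmem
    rw [Multiset.map_cons, Multiset.map_cons, Complex.conj_conj, Multiset.cons_swap,
      Multiset.cons_inj_right, Multiset.cons_inj_right] at hs
    rw [Multiset.map_cons, Multiset.map_cons, Multiset.prod_cons, Multiset.prod_cons, ← mul_assoc,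
      hconj]
    rw [Multiset.card_cons] at hcard
    exact mul_pos (mul_conj_pos (hne z hz1)) (ih u.card (by omega) u hs
      (fun y hy => hlt y (Multiset.mem_cons_of_mem (Multiset.mem_cons_of_mem hy))) rfl)

theorem qPochInf_ofReal_pos {q : ℝ} (hq0 : 0 < q) (hq1 : q < 1) (x : ℝ) (hx : ‖(x : ℂ)‖ < 1) :
    0 < qPochInf x q := by
  refine lt_of_le_of_ne ?_ (qPochInf_ne_zero hq0 hq1 hx).symm
  refine ge_of_tendsto' (multipliable_one_sub_mul_pow hq0 hq1 (x : ℂ)).hasProd.tendsto_prod_nat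
    fun n => Finset.prod_nonneg fun i _ => ?_
  have h := (norm_mul_ofReal_pow_le hq0 hq1 (x : ℂ) i).trans_lt hx
  have h1 : ‖x * q ^ i‖ < 1 := by
    rw [← Complex.norm_real]
    exact_mod_cast h
  have h2 : 0 ≤ 1 - x * q ^ i := by
    have := (abs_lt.1 (by simpa only [Real.norm_eq_abs] using h1)).2
    linarith
  exact_mod_cast h2

theorem conj_unitPt (θ : ℝ) : starRingEnd ℂ (unitPt θ) = (unitPt θ)⁻¹ :=
  (Complex.inv_eq_conj (norm_unitPt θ)).symm

/-- For $|z|=1$ the map $\alpha\mapsto(\alpha z,\alpha/z;q)_\infty$ commutes with conjugation and is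
a squared modulus at real $\alpha$, so its product over the invariant multiset is positive. The
numerator is itself a squared modulus. -/
theorem circleG_pos {q : ℝ} (hq0 : 0 < q) (hq1 : q < 1) {a b c d : ℂ}
    (ha : ‖a‖ < 1) (hb : ‖b‖ < 1) (hc : ‖c‖ < 1) (hd : ‖d‖ < 1)
    (hconj : ({a, b, c, d} : Multiset ℂ).map (starRingEnd ℂ) = {a, b, c, d}) (θ : ℝ) :
    0 < circleG q a b c d (unitPt θ) := by
  have hqn : ‖(q : ℂ)‖ < 1 := by simpa [abs_of_pos hq0] using hq1
  have hden : 0 < (({a, b, c, d} : Multiset ℂ).map fun α =>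
      qPochInf (α * unitPt θ) q * qPochInf (α * (unitPt θ)⁻¹) q).prod := by
    refine prod_map_pos_of_conj_invariant (fun α => ?_)
      (fun α hα => qPochInf_mul_unitPt_ne_zero hq0 hq1 hα θ) (fun x hx => ?_) _ hconj ?_
    · rw [map_mul, ← qPochInf_conj, ← qPochInf_conj, map_mul, map_mul, map_inv₀, conj_unitPt,
        inv_inv, mul_comm]
    · have h := qPochInf_conj q (x * unitPt θ)
      rw [map_mul, Complex.conj_ofReal, conj_unitPt] at h
      rw [h]
      exact mul_conj_pos (left_ne_zero_of_mul (qPochInf_mul_unitPt_ne_zero hq0 hq1 hx θ))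
    · simp [ha, hb, hc, hd]
  have hnum : 0 < qPochInf (q * unitPt θ ^ 2) q * qPochInf (q * (unitPt θ)⁻¹ ^ 2) q := by
    have h := qPochInf_conj q (q * unitPt θ ^ 2)
    rw [map_mul, map_pow, Complex.conj_ofReal, conj_unitPt] at h
    rw [h]
    refine mul_conj_pos (qPochInf_ne_zero hq0 hq1 ?_)
    simpa [norm_unitPt] using hqn
  simp only [Multiset.insert_eq_cons, Multiset.map_cons, Multiset.map_singleton,
    Multiset.prod_cons, Multiset.prod_singleton] at hden
  rw [circleG]
  refine div_pos hnum ?_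
  simpa only [mul_assoc] using hden

/-- The six pairwise products again form a conjugation-invariant multiset in the unit disc, and
$abcd$ is real. -/
theorem awConst_pos {q : ℝ} (hq0 : 0 < q) (hq1 : q < 1) {a b c d : ℂ}
    (ha : ‖a‖ < 1) (hb : ‖b‖ < 1) (hc : ‖c‖ < 1) (hd : ‖d‖ < 1)
    (hconj : ({a, b, c, d} : Multiset ℂ).map (starRingEnd ℂ) = {a, b, c, d}) :
    0 < awConst q a b c d := by
  have hqn : ‖(q : ℂ)‖ < 1 := by simpa [abs_of_pos hq0] using hq1
  have hpairs : 0 < (((({a, b, c, d} : Multiset ℂ).powersetCard 2).map Multiset.prod).map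
      fun α => qPochInf α q).prod := by
    refine prod_map_pos_of_conj_invariant (qPochInf_conj q)
      (fun z hz => qPochInf_ne_zero hq0 hq1 hz) (qPochInf_ofReal_pos hq0 hq1) _ ?_ ?_
    · conv_rhs => rw [← hconj, Multiset.powersetCard_map]
      rw [Multiset.map_map, Multiset.map_map]
      exact Multiset.map_congr rfl fun t _ => map_multiset_prod _ _
    · simp [-norm_mul, -Complex.norm_mul, Multiset.powersetCard_cons, Multiset.powersetCard_one,
        Multiset.powersetCard_zero_left, norm_mul_lt_one, ha, hb, hc, hd]
  have he : starRingEnd ℂ (a * b * c * d) = a * b * c * d := by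
    have := congrArg Multiset.prod hconj
    rw [← map_multiset_prod] at this
    simpa [mul_assoc] using this
  obtain ⟨x, hx⟩ := Complex.conj_eq_iff_real.1 he
  have hden := qPochInf_ofReal_pos hq0 hq1 x (hx ▸ norm_four_mul_lt_one ha hb hc hd)
  have hpi : (0 : ℂ) < 2 * Real.pi := by exact_mod_cast Real.two_pi_pos
  rw [awConst, hx]
  refine div_pos ?_ (mul_pos hpi hden)
  simp [Multiset.powersetCard_cons, Multiset.powersetCard_one, Multiset.powersetCard_zero_left]
    at hpairs
  have := mul_pos (qPochInf_ofReal_pos hq0 hq1 q hqn) hpairs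
  convert this using 1
  ring

/-- The Askey–Wilson weight is real and positive on `(-1, 1)`. -/
theorem exists_awWeight_eq_ofReal {q : ℝ} (hq0 : 0 < q) (hq1 : q < 1) {a b c d : ℂ}
    (ha : ‖a‖ < 1) (hb : ‖b‖ < 1) (hc : ‖c‖ < 1) (hd : ‖d‖ < 1)
    (hconj : ({a, b, c, d} : Multiset ℂ).map (starRingEnd ℂ) = {a, b, c, d}) :
    ∃ w : ℝ → ℝ, Continuous w ∧ (∀ x, awWeight q a b c d x = w x) ∧ (∀ x, 0 ≤ w x) ∧
      ∀ x ∈ Set.Ioo (-1) 1, 0 < w x := by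
  have h1 := fun x => circleG_pos hq0 hq1 ha hb hc hd hconj (Real.arccos x)
  have h2 := awConst_pos hq0 hq1 ha hb hc hd hconj
  have h4 : (0 : ℂ) < 4 := by norm_num
  have hpos : ∀ x, 0 ≤ awWeight q a b c d x := fun x => by
    rw [awWeight_eq hq0 hq1]
    have : (0 : ℂ) ≤ Real.sqrt (1 - x ^ 2) := by exact_mod_cast Real.sqrt_nonneg _
    exact mul_nonneg (mul_pos h4 h2).le (mul_nonneg this (h1 x).le)
  refine ⟨fun x => (awWeight q a b c d x).re,
    Complex.continuous_re.comp (continuous_awWeight hq0 hq1 ha hb hc hd), fun x => ?_,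
    fun x => (Complex.le_def.1 (hpos x)).1, fun x hx => ?_⟩
  · exact Complex.ext rfl (by simpa using (Complex.le_def.1 (hpos x)).2.symm)
  · have : (0 : ℂ) < Real.sqrt (1 - x ^ 2) := by
      exact_mod_cast Real.sqrt_pos.2 (by nlinarith [hx.1, hx.2])
    have h := mul_pos (mul_pos h4 h2) (mul_pos this (h1 x))
    rw [← awWeight_eq hq0 hq1] at h
    exact (Complex.lt_def.1 h).1

/-! ### Positive functionals, reproducing kernels and added point masses. -/

/-- A real positive definite linear functional on complex polynomials. -/
structure IsPosFunctional (L : ℂ[X] →ₗ[ℂ] ℂ) : Prop where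
  pos : ∀ p, p ≠ 0 → 0 < L (p * p.map (starRingEnd ℂ))
  conj : ∀ p, L (p.map (starRingEnd ℂ)) = starRingEnd ℂ (L p)

/-- `P` is monic of degree `n` and orthogonal to all polynomials of smaller degree. -/
structure IsMonicOrth (L : ℂ[X] →ₗ[ℂ] ℂ) (n : ℕ) (P : ℂ[X]) : Prop where
  monic : P.Monic
  natDegree_eq : P.natDegree = n
  orth : ∀ r : ℂ[X], r.degree < n → L (P * r) = 0

theorem map_conj_map_conj (p : ℂ[X]) :
    (p.map (starRingEnd ℂ)).map (starRingEnd ℂ) = p := by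
  ext i
  simp

namespace IsMonicOrth

variable {L : ℂ[X] →ₗ[ℂ] ℂ} {n : ℕ} {P Q : ℂ[X]}

theorem degree_eq (hP : IsMonicOrth L n P) : P.degree = n := by
  rw [degree_eq_natDegree hP.monic.ne_zero, hP.natDegree_eq]

/-- The difference $P-Q$ has degree below $n$, hence is orthogonal to its own conjugate,
contradicting positivity unless it is zero. -/
theorem unique (hL : IsPosFunctional L) (hP : IsMonicOrth L n P) (hQ : IsMonicOrth L n Q) :
    P = Q := by
  by_contra hne
  have hD : P - Q ≠ 0 := sub_ne_zero.2 hne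
  have hdeg : (P - Q).degree < n := by
    have := degree_sub_lt_left (hP.degree_eq.trans hQ.degree_eq.symm) hP.monic.ne_zero
      (hP.monic.leadingCoeff.trans hQ.monic.leadingCoeff.symm)
    rwa [hP.degree_eq] at this
  have hpos := hL.pos _ hD
  have hdeg' : ((P - Q).map (starRingEnd ℂ)).degree < n := by rwa [degree_map]
  rw [sub_mul, map_sub, hP.orth _ hdeg', hQ.orth _ hdeg', sub_zero] at hpos
  exact lt_irrefl _ hpos

/-- The conjugated polynomial satisfies the same conditions, so uniqueness forces real coefficients.
Hence $L(P^2)=L(P\bar P)>0$ and values at real points are real. -/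
theorem map_conj (hL : IsPosFunctional L) (hP : IsMonicOrth L n P) :
    P.map (starRingEnd ℂ) = P := by
  refine unique hL ⟨hP.monic.map _, by rw [natDegree_map, hP.natDegree_eq], fun r hr => ?_⟩ hP
  have h := hL.conj (P * r.map (starRingEnd ℂ))
  rw [hP.orth _ (by rwa [degree_map]), map_zero, Polynomial.map_mul, map_conj_map_conj] at h
  exact h

theorem normSq_pos (hL : IsPosFunctional L) (hP : IsMonicOrth L n P) : 0 < L (P ^ 2) := by
  have h := hL.pos P hP.monic.ne_zero
  rwa [hP.map_conj hL, ← sq] at h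

theorem ofReal_re_eval (hL : IsPosFunctional L) (hP : IsMonicOrth L n P) (x : ℝ) :
    ((P.eval (x : ℂ)).re : ℂ) = P.eval (x : ℂ) := by
  refine Complex.conj_eq_iff_re.1 ?_
  have h := eval_map_apply (starRingEnd ℂ) (p := P) (x : ℂ)
  rw [hP.map_conj hL, Complex.conj_ofReal] at h
  exact h.symm

/-- Orthogonality to a monic sequence gives orthogonality to all polynomials of smaller degree. -/
theorem of_sequence {S : ℕ → ℂ[X]} (hS : ∀ k, (S k).degree = k)
    (hm : P.Monic) (hd : P.natDegree = n) (h : ∀ k < n, L (P * S k) = 0) : IsMonicOrth L n P := by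
  refine ⟨hm, hd, fun r hr => ?_⟩
  let T : Polynomial.Sequence ℂ := ⟨S, hS⟩
  have hspan : r ∈ Submodule.span ℂ (T '' Set.Iio n) := by
    rw [T.span_degreeLT fun i _ => (leadingCoeff_ne_zero.2 (T.ne_zero i)).isUnit]
    exact mem_degreeLT.2 hr
  clear hr
  induction hspan using Submodule.span_induction with
  | mem x hx =>
    obtain ⟨i, hi, rfl⟩ := hx
    exact h i hi
  | zero => simp
  | add x y _ _ hx hy => rw [mul_add, map_add, hx, hy, add_zero]
  | smul t x _ hx => rw [mul_smul_comm, map_smul, hx, smul_zero]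

end IsMonicOrth

/-- The Christoffel–Darboux kernel of the sequence `P` as a polynomial in its first variable. -/
def kernelPoly (L : ℂ[X] →ₗ[ℂ] ℂ) (P : ℕ → ℂ[X]) (n : ℕ) (y : ℂ) : ℂ[X] :=
  ∑ k ∈ Finset.range n, ((P k).eval y / L (P k ^ 2)) • P k

theorem eval_kernelPoly (L : ℂ[X] →ₗ[ℂ] ℂ) (P : ℕ → ℂ[X]) (n : ℕ) (x y : ℂ) :
    (kernelPoly L P n y).eval x =
      ∑ k ∈ Finset.range n, (P k).eval x * (P k).eval y / L (P k ^ 2) := by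
  simp only [kernelPoly, eval_finsetSum, eval_smul, smul_eq_mul]
  exact Finset.sum_congr rfl fun k _ => by ring

variable {L : ℂ[X] →ₗ[ℂ] ℂ} {P : ℕ → ℂ[X]}

theorem degree_kernelPoly_lt (hP : ∀ n, IsMonicOrth L n (P n)) (n : ℕ) (y : ℂ) :
    (kernelPoly L P n y).degree < n := by
  refine (degree_sum_le _ _).trans_lt ((Finset.sup_lt_iff (WithBot.bot_lt_coe n)).2 fun k hk => ?_)
  refine (degree_smul_le _ _).trans_lt ?_
  rw [(hP k).degree_eq]
  exact WithBot.coe_lt_coe.2 (Finset.mem_range.1 hk)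

/-- The reproducing property of the kernel. -/
theorem functional_kernelPoly_mul (hL : IsPosFunctional L) (hP : ∀ n, IsMonicOrth L n (P n))
    (n : ℕ) (y : ℂ) (r : ℂ[X]) (hr : r.degree < n) : L (kernelPoly L P n y * r) = r.eval y := by
  let T : Polynomial.Sequence ℂ := ⟨P, fun k => (hP k).degree_eq⟩
  have hspan : r ∈ Submodule.span ℂ (T '' Set.Iio n) := by
    rw [T.span_degreeLT fun i _ => (leadingCoeff_ne_zero.2 (T.ne_zero i)).isUnit]
    exact mem_degreeLT.2 hr
  clear hr
  induction hspan using Submodule.span_induction with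
  | mem x hx =>
    obtain ⟨i, hi, rfl⟩ := hx
    change L (kernelPoly L P n y * P i) = (P i).eval y
    rw [kernelPoly, Finset.sum_mul, map_sum, Finset.sum_eq_single i]
    · rw [smul_mul_assoc, map_smul, ← sq, smul_eq_mul,
        div_mul_cancel₀ _ ((hP i).normSq_pos hL).ne']
    · intro k _ hki
      rw [smul_mul_assoc, map_smul]
      obtain hlt | hlt := lt_or_gt_of_ne hki
      · rw [mul_comm, (hP i).orth _ (by rw [(hP k).degree_eq]; exact_mod_cast hlt), smul_zero]
      · rw [(hP k).orth _ (by rw [(hP i).degree_eq]; exact_mod_cast hlt), smul_zero]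
    · intro h
      exact absurd (Finset.mem_range.2 hi) h
  | zero => simp
  | add x y _ _ hx hy => rw [mul_add, map_add, hx, hy, eval_add]
  | smul t x _ hx => rw [mul_smul_comm, map_smul, hx, eval_smul]

/-- The determinant of the kernel system with masses `A`, `B` at the real points `s`, `t` is
positive. -/
theorem kernel_det_pos (hL : IsPosFunctional L) (hP : ∀ n, IsMonicOrth L n (P n))
    {A B : ℝ} (hA : 0 < A) (hB : 0 < B) (n : ℕ) (s t : ℝ) :
    let K := fun x y : ℂ => (kernelPoly L P n y).eval x
    0 < (1 + A * K s s) * (1 + B * K t t) - B * K s t * (A * K t s) := by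
  intro K
  have hd : ∀ k, 0 < (L (P k ^ 2)).re ∧ ((L (P k ^ 2)).re : ℂ) = L (P k ^ 2) := fun k => by
    have h := Complex.lt_def.1 ((hP k).normSq_pos hL)
    exact ⟨h.1, Complex.ext rfl h.2⟩
  let k' := fun x y : ℝ => ∑ k ∈ Finset.range n,
    ((P k).eval (x : ℂ)).re * ((P k).eval (y : ℂ)).re / (L (P k ^ 2)).re
  have hK : ∀ x y : ℝ, K x y = k' x y := fun x y => by
    simp only [K, k', eval_kernelPoly]
    push_cast
    refine Finset.sum_congr rfl fun k _ => ?_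
    rw [(hP k).ofReal_re_eval hL, (hP k).ofReal_re_eval hL, (hd k).2]
  have hnn : ∀ x : ℝ, 0 ≤ k' x x := fun x =>
    Finset.sum_nonneg fun k _ => div_nonneg (mul_self_nonneg _) (hd k).1.le
  have hcomm : k' t s = k' s t := Finset.sum_congr rfl fun k _ => by
    rw [mul_comm ((P k).eval (t : ℂ)).re]
  have hcs : k' s t ^ 2 ≤ k' s s * k' t t := by
    refine Finset.sum_sq_le_sum_mul_sum_of_sq_le_mul _
      (fun k _ => div_nonneg (mul_self_nonneg _) (hd k).1.le)
      (fun k _ => div_nonneg (mul_self_nonneg _) (hd k).1.le) fun k _ => ?_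
    have := (hd k).1.ne'
    refine le_of_eq ?_
    field_simp
  rw [hK, hK, hK, hK, hcomm]
  -- The determinant is $1+AK(s,s)+BK(t,t)+AB\,(K(s,s)K(t,t)-K(s,t)^2)$, the last bracket being
  -- nonnegative by Cauchy–Schwarz.
  have h1 := mul_nonneg hA.le (hnn s)
  have h2 := mul_nonneg hB.le (hnn t)
  have h3 := mul_nonneg (mul_pos hA hB).le (sub_nonneg.2 hcs)
  have : 0 < (1 + A * k' s s) * (1 + B * k' t t) - B * k' s t * (A * k' s t) := by nlinarith
  exact_mod_cast this

/-- The functional `L` with point masses `A`, `B` added at `s`, `t`. -/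
def addMasses (L : ℂ[X] →ₗ[ℂ] ℂ) (A B s t : ℝ) : ℂ[X] →ₗ[ℂ] ℂ :=
  L + (A : ℂ) • leval (s : ℂ) + (B : ℂ) • leval (t : ℂ)

theorem addMasses_apply (L : ℂ[X] →ₗ[ℂ] ℂ) (A B s t : ℝ) (p : ℂ[X]) :
    addMasses L A B s t p = L p + A * p.eval (s : ℂ) + B * p.eval (t : ℂ) := by
  simp [addMasses]

theorem eval_map_conj_ofReal (p : ℂ[X]) (x : ℝ) :
    (p.map (starRingEnd ℂ)).eval (x : ℂ) = starRingEnd ℂ (p.eval (x : ℂ)) := by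
  have h := eval_map_apply (starRingEnd ℂ) (p := p) (x : ℂ)
  rwa [Complex.conj_ofReal] at h

theorem isPosFunctional_addMasses (hL : IsPosFunctional L) {A B : ℝ} (hA : 0 < A) (hB : 0 < B)
    (s t : ℝ) : IsPosFunctional (addMasses L A B s t) where
  pos p hp := by
    have h : ∀ z : ℂ, 0 ≤ z * starRingEnd ℂ z := fun z => by
      rw [Complex.mul_conj]
      exact_mod_cast Complex.normSq_nonneg z
    have hA' : (0 : ℂ) ≤ A := by exact_mod_cast hA.le
    have hB' : (0 : ℂ) ≤ B := by exact_mod_cast hB.le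
    rw [addMasses_apply, eval_mul, eval_mul, eval_map_conj_ofReal, eval_map_conj_ofReal]
    exact add_pos_of_pos_of_nonneg (add_pos_of_pos_of_nonneg (hL.pos p hp)
      (mul_nonneg hA' (h _))) (mul_nonneg hB' (h _))
  conj p := by
    simp only [addMasses_apply, eval_map_conj_ofReal, hL.conj, map_add, map_mul,
      Complex.conj_ofReal]

/-- The polynomials `P_n - A y₁ K_{n-1}(x, s) - B y₂ K_{n-1}(x, t)` are orthogonal for the
functional with point masses as soon as `y₁`, `y₂` are their values at `s`, `t`. -/
theorem isMonicOrth_addMasses (hL : IsPosFunctional L) (hP : ∀ n, IsMonicOrth L n (P n))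
    (A B s t : ℝ) (n : ℕ) (y₁ y₂ : ℂ) (R : ℂ[X])
    (hR : R = P n - (A * y₁) • kernelPoly L P n s - (B * y₂) • kernelPoly L P n t)
    (h₁ : R.eval (s : ℂ) = y₁) (h₂ : R.eval (t : ℂ) = y₂) :
    IsMonicOrth (addMasses L A B s t) n R := by
  have hdeg : ((A * y₁) • kernelPoly L P n s + (B * y₂) • kernelPoly L P n t).degree < n :=
    (degree_add_le _ _).trans_lt (max_lt
      ((degree_smul_le _ _).trans_lt (degree_kernelPoly_lt hP n _))
      ((degree_smul_le _ _).trans_lt (degree_kernelPoly_lt hP n _)))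
  have hdegR : R.degree = n := by
    rw [hR, sub_sub, degree_sub_eq_left_of_degree_lt (by rwa [(hP n).degree_eq]),
      (hP n).degree_eq]
  refine ⟨?_, natDegree_eq_of_degree_eq_some hdegR, fun r hr => ?_⟩
  · rw [hR, sub_sub]
    exact (hP n).monic.sub_of_left (by rwa [(hP n).degree_eq])
  -- The reproducing property makes the kernel terms contribute exactly the negatives of the two
  -- point-mass terms.
  · have hLR : L (R * r) = -(A * y₁ * r.eval (s : ℂ)) - B * y₂ * r.eval (t : ℂ) := by
      rw [hR, sub_mul, sub_mul, map_sub, map_sub, (hP n).orth r hr, smul_mul_assoc, map_smul,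
        smul_mul_assoc, map_smul, functional_kernelPoly_mul hL hP n _ r hr,
        functional_kernelPoly_mul hL hP n _ r hr, smul_eq_mul, smul_eq_mul, zero_sub]
    rw [addMasses_apply, hLR, eval_mul, eval_mul, h₁, h₂]
    ring

/-! ### Application to the Askey–Wilson functional. -/

/-- The Askey–Wilson functional as a linear map. -/
def awLin {q : ℝ} (hq0 : 0 < q) (hq1 : q < 1) {a b c d : ℂ}
    (ha : ‖a‖ < 1) (hb : ‖b‖ < 1) (hc : ‖c‖ < 1) (hd : ‖d‖ < 1) : ℂ[X] →ₗ[ℂ] ℂ :=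
  (2 * awConst q a b c d) • circleLin hq0 hq1 ha hb hc hd

theorem awLin_apply {q : ℝ} (hq0 : 0 < q) (hq1 : q < 1) {a b c d : ℂ}
    (ha : ‖a‖ < 1) (hb : ‖b‖ < 1) (hc : ‖c‖ < 1) (hd : ‖d‖ < 1) (p : ℂ[X]) :
    awLin hq0 hq1 ha hb hc hd p = awFunctional q a b c d p :=
  (awFunctional_eq hq0 hq1 ha hb hc hd p).symm

/-- The weight is continuous, nonnegative, and positive on $(-1,1)$, where a nonzero polynomial
cannot vanish identically; so the integral of $|p|^2\rho$ is positive. -/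
theorem isPosFunctional_awLin {q : ℝ} (hq0 : 0 < q) (hq1 : q < 1) {a b c d : ℂ}
    (ha : ‖a‖ < 1) (hb : ‖b‖ < 1) (hc : ‖c‖ < 1) (hd : ‖d‖ < 1)
    (hconj : ({a, b, c, d} : Multiset ℂ).map (starRingEnd ℂ) = {a, b, c, d}) :
    IsPosFunctional (awLin hq0 hq1 ha hb hc hd) := by
  obtain ⟨w, hwc, hw, hw0, hwpos⟩ := exists_awWeight_eq_ofReal hq0 hq1 ha hb hc hd hconj
  refine ⟨fun p hp => ?_, fun p => ?_⟩
  · have hint : awLin hq0 hq1 ha hb hc hd (p * p.map (starRingEnd ℂ)) =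
        ((∫ x in (-1 : ℝ)..1, Complex.normSq (p.eval (x : ℂ)) * w x : ℝ) : ℂ) := by
      rw [awLin_apply, awFunctional, ← intervalIntegral.integral_ofReal]
      refine intervalIntegral.integral_congr fun x _ => ?_
      simp only [eval_mul, eval_map_conj_ofReal, Complex.mul_conj, hw]
      push_cast
      rfl
    rw [hint]
    obtain ⟨x, hx, hpx⟩ : ∃ x ∈ Set.Ioo (-1 : ℝ) 1, p.eval (x : ℂ) ≠ 0 := by
      by_contra! h
      refine hp (eq_zero_of_infinite_isRoot p (Set.Infinite.mono (s := Complex.ofReal '' Set.Ioo (-1) 1)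
        ?_ ((Set.Ioo_infinite (by norm_num)).image Complex.ofReal_injective.injOn)))
      rintro _ ⟨x, hx, rfl⟩
      exact h x hx
    have : 0 < ∫ x in (-1 : ℝ)..1, Complex.normSq (p.eval (x : ℂ)) * w x :=
      intervalIntegral.integral_pos (by norm_num)
        ((Complex.continuous_normSq.comp (continuous_eval_ofReal p)).mul hwc).continuousOn
        (fun x _ => mul_nonneg (Complex.normSq_nonneg _) (hw0 x))
        ⟨x, Set.Ioo_subset_Icc_self hx, mul_pos (Complex.normSq_pos.2 hpx) (hwpos x hx)⟩
    exact_mod_cast this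
  · rw [awLin_apply, awLin_apply, awFunctional, awFunctional,
      intervalIntegral.integral_of_le (by norm_num), intervalIntegral.integral_of_le (by norm_num),
      ← integral_conj]
    refine MeasureTheory.integral_congr_ae (.of_forall fun x => ?_)
    simp only [eval_map_conj_ofReal, hw, map_mul, Complex.conj_ofReal]

theorem isMonicOrth_awPoly {q : ℝ} (hq0 : 0 < q) (hq1 : q < 1) {a b c d : ℂ} (ha0 : a ≠ 0)
    (ha : ‖a‖ < 1) (hb : ‖b‖ < 1) (hc : ‖c‖ < 1) (hd : ‖d‖ < 1) (n : ℕ) :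
    IsMonicOrth (awLin hq0 hq1 ha hb hc hd) n (awPoly q a b c d n) := by
  refine ⟨awPoly_monic hq0 hq1 ha0 ha hb hc hd n, natDegree_awPoly hq0 hq1 ha0 ha hb hc hd n,
    fun r hr => ?_⟩
  obtain rfl | hr0 := eq_or_ne r 0
  · simp
  · rw [awLin_apply, awFunctional_eq hq0 hq1 ha hb hc hd,
      circleFunctional_awPoly_mul hq0 hq1 ha hb hc hd n r ((natDegree_lt_iff_degree_lt hr0).2 hr),
      mul_zero]

theorem awKernelPred_eq {q : ℝ} (hq0 : 0 < q) (hq1 : q < 1) {a b c d : ℂ}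
    (ha : ‖a‖ < 1) (hb : ‖b‖ < 1) (hc : ‖c‖ < 1) (hd : ‖d‖ < 1) (n : ℕ) (x y : ℂ) :
    awKernelPred q a b c d n x y =
      (kernelPoly (awLin hq0 hq1 ha hb hc hd) (awPoly q a b c d) n y).eval x := by
  simp only [eval_kernelPoly, awKernelPred, awNormSq, awLin_apply]

theorem krallFunctional_eq {q : ℝ} (hq0 : 0 < q) (hq1 : q < 1) {a b c d : ℂ}
    (ha : ‖a‖ < 1) (hb : ‖b‖ < 1) (hc : ‖c‖ < 1) (hd : ‖d‖ < 1) (A B : ℝ) (p : ℂ[X]) :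
    krallFunctional q a b c d A B p =
      addMasses (awLin hq0 hq1 ha hb hc hd) A B (-1) 1 p := by
  rw [addMasses_apply, krallFunctional, awLin_apply, Complex.ofReal_neg, Complex.ofReal_one]

/-- Pairwise orthogonality of a sequence with one polynomial per degree is orthogonality to
everything of lower degree. This reduces uniqueness of sequences to uniqueness degree by degree. -/
theorem isMonicOPS_iff {L : ℂ[X] →ₗ[ℂ] ℂ} (hL : IsPosFunctional L) (P : ℕ → ℂ[X]) :
    IsMonicOPS L P ↔ ∀ n, IsMonicOrth L n (P n) := by
  constructor
  · intro h n
    refine .of_sequence (S := P) (fun k => ?_) (h.monic n) (h.natDegree_eq n)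
      fun k hk => h.orthogonal n k hk.ne'
    rw [degree_eq_natDegree (h.monic k).ne_zero, h.natDegree_eq]
  · refine fun h => ⟨fun n => (h n).monic, fun n => (h n).natDegree_eq, fun n m hnm => ?_,
      fun n => ((h n).normSq_pos hL).ne'⟩
    obtain hlt | hlt := lt_or_gt_of_ne hnm
    · rw [mul_comm, (h m).orth _ (by rw [(h n).degree_eq]; exact_mod_cast hlt)]
    · rw [(h n).orth _ (by rw [(h m).degree_eq]; exact_mod_cast hlt)]

end

theorem mainTheorem1 (q : ℝ) (hq0 : 0 < q) (hq1 : q < 1) (a b c d : ℂ)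
    (ha0 : a ≠ 0) (ha : ‖a‖ < 1) (hb : ‖b‖ < 1) (hc : ‖c‖ < 1) (hd : ‖d‖ < 1)
    (hconj : ({a, b, c, d} : Multiset ℂ).map (starRingEnd ℂ) = {a, b, c, d})
    (A B : ℝ) (hA : 0 < A) (hB : 0 < B) :
    -- the functional `u` and the kernels are well defined
    (∀ p : ℂ[X], IntervalIntegrable (fun x : ℝ => p.eval (x : ℂ) * awWeight q a b c d x)
      MeasureTheory.volume (-1) 1) ∧
    (∀ n, 0 < awNormSq q a b c d n) ∧
    -- the determinants are real and positive
    (∀ n, 0 < awKappaPred q a b c d A B n) ∧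
    -- existence, uniqueness and explicit form of the monic orthogonal polynomials
    ∃ Pt : ℕ → ℂ[X],
      IsMonicOPS (krallFunctional q a b c d A B) Pt ∧
      (∀ Q : ℕ → ℂ[X], IsMonicOPS (krallFunctional q a b c d A B) Q → Q = Pt) ∧
      ∀ n : ℕ,
        (∀ x : ℂ, (Pt n).eval x = (awPoly q a b c d n).eval x
          - A * (Pt n).eval (-1) * awKernelPred q a b c d n x (-1)
          - B * (Pt n).eval 1 * awKernelPred q a b c d n x 1) ∧
        ![(Pt n).eval (-1), (Pt n).eval 1] =
          (kernelMatrix q a b c d A B n)⁻¹.mulVec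
            ![(awPoly q a b c d n).eval (-1), (awPoly q a b c d n).eval 1] ∧
        (Pt n).eval (-1) =
          ((1 + B * awKernelPred q a b c d n 1 1) * (awPoly q a b c d n).eval (-1)
            - B * awKernelPred q a b c d n (-1) 1 * (awPoly q a b c d n).eval 1) /
          awKappaPred q a b c d A B n ∧
        (Pt n).eval 1 =
          ((1 + A * awKernelPred q a b c d n (-1) (-1)) * (awPoly q a b c d n).eval 1
            - A * awKernelPred q a b c d n 1 (-1) * (awPoly q a b c d n).eval (-1)) /
          awKappaPred q a b c d A B n ∧
        krallFunctional q a b c d A B (Pt n ^ 2) =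
          awNormSq q a b c d n
            + A * (Pt n).eval (-1) * (awPoly q a b c d n).eval (-1)
            + B * (Pt n).eval 1 * (awPoly q a b c d n).eval 1 := by
  have hL := isPosFunctional_awLin hq0 hq1 ha hb hc hd hconj
  have hP := isMonicOrth_awPoly hq0 hq1 ha0 ha hb hc hd
  have hLt := isPosFunctional_addMasses hL hA hB (-1) 1
  have hfun : krallFunctional q a b c d A B = addMasses (awLin hq0 hq1 ha hb hc hd) A B (-1) 1 :=
    funext (krallFunctional_eq hq0 hq1 ha hb hc hd A B)
  have hK := awKernelPred_eq hq0 hq1 ha hb hc hd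
  have hkappa_eq : ∀ n, awKappaPred q a b c d A B n =
      (1 + A * awKernelPred q a b c d n (-1) (-1)) * (1 + B * awKernelPred q a b c d n 1 1) -
        B * awKernelPred q a b c d n (-1) 1 * (A * awKernelPred q a b c d n 1 (-1)) := fun n => by
    rw [awKappaPred, kernelMatrix, Matrix.det_fin_two_of]
  have hkappa : ∀ n, 0 < awKappaPred q a b c d A B n := fun n => by
    have h := kernel_det_pos hL hP hA hB n (-1) 1
    simp only [Complex.ofReal_neg, Complex.ofReal_one, ← hK] at h
    rwa [hkappa_eq]
  -- The values at $\pm1$ are prescribed by Cramer's rule before the polynomial exists; `hR1` and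
  -- `hR2` then check that the resulting `R n` really takes them.
  obtain ⟨y₁, hy₁⟩ : ∃ y₁ : ℕ → ℂ, ∀ n, y₁ n =
      ((1 + B * awKernelPred q a b c d n 1 1) * (awPoly q a b c d n).eval (-1)
        - B * awKernelPred q a b c d n (-1) 1 * (awPoly q a b c d n).eval 1) /
        awKappaPred q a b c d A B n := ⟨_, fun _ => rfl⟩
  obtain ⟨y₂, hy₂⟩ : ∃ y₂ : ℕ → ℂ, ∀ n, y₂ n =
      ((1 + A * awKernelPred q a b c d n (-1) (-1)) * (awPoly q a b c d n).eval 1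
        - A * awKernelPred q a b c d n 1 (-1) * (awPoly q a b c d n).eval (-1)) /
        awKappaPred q a b c d A B n := ⟨_, fun _ => rfl⟩
  obtain ⟨R, hR⟩ : ∃ R : ℕ → ℂ[X], ∀ n, R n = awPoly q a b c d n
      - (A * y₁ n) • kernelPoly (awLin hq0 hq1 ha hb hc hd) (awPoly q a b c d) n ((-1 : ℝ) : ℂ)
      - (B * y₂ n) • kernelPoly (awLin hq0 hq1 ha hb hc hd) (awPoly q a b c d) n ((1 : ℝ) : ℂ) :=
    ⟨_, fun _ => rfl⟩
  have hReval : ∀ n x, (R n).eval x = (awPoly q a b c d n).eval x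
      - A * y₁ n * awKernelPred q a b c d n x (-1)
      - B * y₂ n * awKernelPred q a b c d n x 1 := fun n x => by
    rw [hR, eval_sub, eval_sub, eval_smul, eval_smul, hK, hK, Complex.ofReal_neg,
      Complex.ofReal_one, smul_eq_mul, smul_eq_mul]
  have hR1 : ∀ n, (R n).eval (-1) = y₁ n := fun n => by
    have hk := (hkappa n).ne'
    rw [hReval, hy₁, hy₂]
    field_simp
    rw [hkappa_eq]
    ring
  have hR2 : ∀ n, (R n).eval 1 = y₂ n := fun n => by
    have hk := (hkappa n).ne'
    rw [hReval, hy₁, hy₂]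
    field_simp
    rw [hkappa_eq]
    ring
  have hRorth : ∀ n, IsMonicOrth (addMasses (awLin hq0 hq1 ha hb hc hd) A B (-1) 1) n (R n) :=
    fun n => isMonicOrth_addMasses hL hP A B (-1) 1 n (y₁ n) (y₂ n) (R n) (hR n)
      (by simpa using hR1 n) (by simpa using hR2 n)
  refine ⟨fun p => ((continuous_eval_ofReal p).mul
    (continuous_awWeight hq0 hq1 ha hb hc hd)).intervalIntegrable _ _, fun n => ?_, hkappa, R, ?_,
    fun Q hQ => ?_, fun n => ⟨fun x => ?_, ?_, ?_, ?_, ?_⟩⟩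
  · rw [awNormSq, ← awLin_apply hq0 hq1 ha hb hc hd]
    exact (hP n).normSq_pos hL
  · rw [hfun]
    exact (isMonicOPS_iff hLt R).2 hRorth
  · rw [hfun] at hQ
    exact funext fun n => ((isMonicOPS_iff hLt Q).1 hQ n).unique hLt (hRorth n)
  · rw [hReval, hR1, hR2]
  · have hdet : (kernelMatrix q a b c d A B n).det ≠ 0 := (hkappa n).ne'
    have hvec : ![(awPoly q a b c d n).eval (-1), (awPoly q a b c d n).eval 1] =
        (kernelMatrix q a b c d A B n).mulVec ![(R n).eval (-1), (R n).eval 1] := by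
      have h1 := hReval n (-1)
      have h2 := hReval n 1
      rw [← hR1, ← hR2] at h1 h2
      ext i
      fin_cases i
      · simp [kernelMatrix, Matrix.mulVec, dotProduct, Fin.sum_univ_two]
        linear_combination -h1
      · simp [kernelMatrix, Matrix.mulVec, dotProduct, Fin.sum_univ_two]
        linear_combination -h2
    rw [hvec, Matrix.mulVec_mulVec, Matrix.nonsing_inv_mul _ (isUnit_iff_ne_zero.2 hdet),
      Matrix.one_mulVec]
  · rw [hR1, hy₁]
  · rw [hR2, hy₂]
  -- Both polynomials are monic of degree $n$, so their difference is invisible to each: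
  -- $\langle\tilde u,R_n^2\rangle=\langle\tilde u,R_nP_n\rangle$ and $\langle
  -- u,R_nP_n\rangle=\langle u,P_n^2\rangle$. Only the mass terms remain.
  · have hdeg : (R n - awPoly q a b c d n).degree < n := by
      have := degree_sub_lt_left ((hRorth n).degree_eq.trans (hP n).degree_eq.symm)
        (hRorth n).monic.ne_zero
        ((hRorth n).monic.leadingCoeff.trans (hP n).monic.leadingCoeff.symm)
      rwa [(hRorth n).degree_eq] at this
    have h1 := (hRorth n).orth _ hdeg
    have h2 := (hP n).orth _ hdeg
    rw [mul_sub, map_sub, sub_eq_zero, addMasses_apply _ _ _ _ _ (_ * awPoly q a b c d n), ← sq,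
      eval_mul, eval_mul, Complex.ofReal_neg, Complex.ofReal_one] at h1
    rw [mul_sub, map_sub, sub_eq_zero, ← sq, mul_comm] at h2
    rw [hfun, h1, h2, awLin_apply, awNormSq]
    ring
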